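/- Let $\Lambda$ be a (not necessarily commutative) left and right Noetherian ring. Write $\operatorname{mod}\Lambda$ for the category of finitely generated $\Lambda$-modules, and $(-)^*=\operatorname{Hom}(-,\Lambda)$ for the duality functors between left and right $\Lambda$-modules. A module $X\in\operatorname{mod}\Lambda$ is *torsion-free* (resp. *reflexive*) if the canonical map $X\to X^{**}$ is injective (resp. bijective), and $\operatorname{refl}\Lambda\subset\operatorname{mod}\Lambda$ is the full subcategory of reflexive modules. The *strong grade* of a module $X$ is $$\operatorname{s.grade}X=\inf\{n\ge 0\mid \operatorname{Ext}^n_\Lambda(X',\Lambda)\neq 0\text{ for some submodule }X'\subset X\}\in\mathbb{N}\cup\{\infty\}.$$ Assume that $\Lambda$ satisfies the two-sided $(2,2)$-condition: $\operatorname{s.grade}\operatorname{Ext}^2_{\Lambda^{\mathrm{op}}}(X,\Lambda)\ge 2$ for all $X\in\operatorname{mod}\Lambda^{\mathrm{op}}$, and $\operatorname{s.grade}\operatorname{Ext}^2_{\Lambda}(X,\Lambda)\ge 2$ for all $X\in\operatorname{mod}\Lambda$. Then the additive category $\operatorname{refl}\Lambda$ has a maximum exact structure (in the sense of Quillen), and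 its conflations are exactly the kernel-cokernel pairs in $\operatorname{refl}\Lambda$. Moreover, for a complex $L\xrightarrow{f}M\xrightarrow{g}N$ in $\operatorname{refl}\Lambda$ the following are equivalent. 1. $L\xrightarrow{f}M\xrightarrow{g}N$ is a conflation in this maximum exact structure. 2. $f$ is a kernel of $g$ in $\operatorname{mod}\Lambda$, the module $C:=\operatorname{Coker}f\in\operatorname{mod}\Lambda$ is torsion-free, and $g$ factors as $M\twoheadrightarrow C\hookrightarrow C^{**}\xrightarrow{\ \simeq\ }N$, where the first two maps are the canonical ones and the last one is some isomorphism. 3. The sequence $0\to L\xrightarrow{f}M\xrightarrow{g}N$ is exact in $\operatorname{mod}\Lambda$, and the cokernel of $g$ in $\operatorname{mod}\Lambda$ satisfies $\operatorname{s.grade}\operatorname{Coker}g\ge 2$. -/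

import Mathlib

open CategoryTheory CategoryTheory.Limits CategoryTheory.Abelian

universe u

namespace ReflConflation

/-! ### Strong grade, Ext of bimodules, and the two-sided `(l, n)`-condition -/

section Grade

/-- The strong grade of an `R`-module `X`, measured against an `R`-module `U` (below always the
regular left or right module of a ring): the infimum in `ℕ∞` of all `n` such that
`Ext^n_R(N, U) ≠ 0` for some submodule `N` of `X`. -/
noncomputable def strongGrade (R : Type u) [Ring R] (U : Type u) [AddCommGroup U] [Module R U]
    (X : Type u) [AddCommGroup X] [Module R X] : ℕ∞ :=
  ⨅ (n : ℕ) (_ : ∃ N : Submodule R X, Nontrivial (Ext (ModuleCat.of R N) (ModuleCat.of R U) n)),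
    (n : ℕ∞)

variable (A B : Type u) [Ring A] [Ring B] (U : Type u) [AddCommGroup U] [Module A U] [Module B U]
  [SMulCommClass B A U]

/-- If `U` carries commuting actions of `A` and `B`, then `Ext^n_A(X, U)` is a `B`-module: `b : B`
acts by functoriality, through the `A`-linear endomorphism `u ↦ b • u` of `U`. -/
@[reducible]
noncomputable def extModule (X : ModuleCat.{u} A) (n : ℕ) :
    Module B (Ext X (ModuleCat.of A U) n) where
  smul b e := e.comp (Ext.mk₀ (ModuleCat.ofHom (DistribSMul.toLinearMap A U b))) (add_zero n)
  one_smul e := by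
    change e.comp (Ext.mk₀ (ModuleCat.ofHom (DistribSMul.toLinearMap A U (1 : B))))
      (add_zero n) = e
    have h : ModuleCat.ofHom (DistribSMul.toLinearMap A U (1 : B)) = 𝟙 (ModuleCat.of A U) := by
      ext x; exact one_smul B x
    rw [h, Ext.comp_mk₀_id]
  mul_smul b c e := by
    change e.comp (Ext.mk₀ (ModuleCat.ofHom (DistribSMul.toLinearMap A U (b * c))))
      (add_zero n) =
      (e.comp (Ext.mk₀ (ModuleCat.ofHom (DistribSMul.toLinearMap A U c))) (add_zero n)).comp
        (Ext.mk₀ (ModuleCat.ofHom (DistribSMul.toLinearMap A U b))) (add_zero n)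
    have h : ModuleCat.ofHom (DistribSMul.toLinearMap A U (b * c)) =
        ModuleCat.ofHom (DistribSMul.toLinearMap A U c) ≫
          ModuleCat.ofHom (DistribSMul.toLinearMap A U b) := by
      ext x; exact mul_smul b c x
    rw [h, ← Ext.mk₀_comp_mk₀, Ext.comp_assoc_of_third_deg_zero]
  smul_zero b := Ext.zero_comp (X := X) (n := n) _ _ (add_zero n)
  smul_add b e e' := Ext.add_comp _ _ _ _
  add_smul b c e := by
    change e.comp (Ext.mk₀ (ModuleCat.ofHom (DistribSMul.toLinearMap A U (b + c))))
      (add_zero n) =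
      e.comp (Ext.mk₀ (ModuleCat.ofHom (DistribSMul.toLinearMap A U b))) (add_zero n) +
      e.comp (Ext.mk₀ (ModuleCat.ofHom (DistribSMul.toLinearMap A U c))) (add_zero n)
    have h : ModuleCat.ofHom (DistribSMul.toLinearMap A U (b + c)) =
        ModuleCat.ofHom (DistribSMul.toLinearMap A U b) +
          ModuleCat.ofHom (DistribSMul.toLinearMap A U c) := by
      ext x; exact add_smul b c x
    rw [h, Ext.mk₀_add, Ext.comp_add]
  zero_smul e := by
    change e.comp (Ext.mk₀ (ModuleCat.ofHom (DistribSMul.toLinearMap A U (0 : B))))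
      (add_zero n) = 0
    have h : ModuleCat.ofHom (DistribSMul.toLinearMap A U (0 : B)) =
        (0 : ModuleCat.of A U ⟶ ModuleCat.of A U) := by
      ext x; exact zero_smul B x
    rw [h, Ext.mk₀_zero, Ext.comp_zero]

/-- For a bimodule `U`, all finitely generated `A`-modules `X` satisfy
`sgrade_B Ext^l_A(X, U) ≥ n`. -/
def SGradeExtCondition (l n : ℕ) : Prop :=
  ∀ (X : ModuleCat.{u} A), Module.Finite A X →
    letI := extModule A B U X l
    (n : ℕ∞) ≤ strongGrade B U (Ext X (ModuleCat.of A U) l)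

end Grade

/-- The two-sided `(l, n)`-condition on a ring `Λ`. Right `Λ`-modules are modules over `Λᵐᵒᵖ`, and
`Λ` is regarded as a left and a right module over itself. The first half is the
`(l, n)`-condition on `Λ`, the second half is the `(l, n)`-condition on the opposite ring. -/
def TwoSidedCondition (Λ : Type u) [Ring Λ] (l n : ℕ) : Prop :=
  SGradeExtCondition Λᵐᵒᵖ Λ Λ l n ∧ SGradeExtCondition Λ Λᵐᵒᵖ Λ l n

/-! ### Duals, torsion-free and reflexive modules -/

section Dual

variable (Λ : Type u) [Ring Λ]

/-- The dual `X^* = Hom_Λ(X, Λ)` of a left module, a right module. -/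
abbrev Dual (X : Type u) [AddCommGroup X] [Module Λ X] : Type u := X →ₗ[Λ] Λ

/-- The double dual `X^** = Hom_{Λᵐᵒᵖ}(X^*, Λ)` of a left module, again a left module. -/
abbrev DoubleDual (X : Type u) [AddCommGroup X] [Module Λ X] : Type u := Dual Λ X →ₗ[Λᵐᵒᵖ] Λ

/-- The canonical `Λ`-linear map `X → X^**`, `x ↦ (φ ↦ φ x)`. -/
def evalMap (X : Type u) [AddCommGroup X] [Module Λ X] : X →ₗ[Λ] DoubleDual Λ X where
  toFun x :=
    { toFun := fun φ => φ x
      map_add' := fun _ _ => rfl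
      map_smul' := fun _ _ => rfl }
  map_add' x y := by ext φ; exact map_add φ x y
  map_smul' a x := by ext φ; exact map_smul φ a x

/-- `X` is torsion-free: the canonical map `X → X^**` is injective. -/
def IsTorsionFree (X : Type u) [AddCommGroup X] [Module Λ X] : Prop :=
  Function.Injective (evalMap Λ X)

/-- A finitely generated module `X` is reflexive: the canonical map `X → X^**` is bijective. -/
def isReflexive : ObjectProperty (FGModuleCat.{u} Λ) :=
  fun X => Function.Bijective (evalMap Λ X)

/-- The category `refl Λ` of finitely generated reflexive `Λ`-modules, a full subcategory of the
category `mod Λ` of finitely generated `Λ`-modules. -/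
abbrev Refl : Type (u + 1) := (isReflexive Λ).FullSubcategory

variable {Λ}

/-- The `Λ`-linear map underlying a morphism of `refl Λ`. -/
abbrev Refl.lin {M N : Refl Λ} (f : M ⟶ N) : M.obj →ₗ[Λ] N.obj := f.hom.hom.hom

theorem isReflexive_prod (M N : Refl Λ) :
    isReflexive Λ (FGModuleCat.of Λ (M.obj × N.obj)) := by
  constructor
  · rintro ⟨m, n⟩ ⟨m', n'⟩ h
    have h' : ∀ φ : Dual Λ (M.obj × N.obj), φ (m, n) = φ (m', n') :=
      fun φ => LinearMap.congr_fun h φ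
    refine Prod.ext (M.property.1 ?_) (N.property.1 ?_)
    · ext φ; exact h' (φ.comp (LinearMap.fst Λ _ _))
    · ext φ; exact h' (φ.comp (LinearMap.snd Λ _ _))
  · intro Φ
    obtain ⟨m, hm⟩ := M.property.2
      { toFun := fun φ => Φ (φ.comp (LinearMap.fst Λ M.obj N.obj))
        map_add' := fun φ ψ => by rw [LinearMap.add_comp, map_add]
        map_smul' := fun a φ => by rw [LinearMap.smul_comp, map_smul]; rfl }
    obtain ⟨n, hn⟩ := N.property.2
      { toFun := fun φ => Φ (φ.comp (LinearMap.snd Λ M.obj N.obj))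
        map_add' := fun φ ψ => by rw [LinearMap.add_comp, map_add]
        map_smul' := fun a φ => by rw [LinearMap.smul_comp, map_smul]; rfl }
    refine ⟨(m, n), ?_⟩
    ext φ
    have e₁ : φ (m, 0) = Φ ((φ.comp (LinearMap.inl Λ M.obj N.obj)).comp (LinearMap.fst Λ _ _)) :=
      LinearMap.congr_fun hm (φ.comp (LinearMap.inl Λ M.obj N.obj))
    have e₂ : φ (0, n) = Φ ((φ.comp (LinearMap.inr Λ M.obj N.obj)).comp (LinearMap.snd Λ _ _)) :=
      LinearMap.congr_fun hn (φ.comp (LinearMap.inr Λ M.obj N.obj))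
    change φ (m, n) = Φ φ
    have e₃ : ((m, n) : M.obj × N.obj) = (m, 0) + (0, n) := by simp
    rw [e₃, map_add, e₁, e₂, ← map_add]
    congr 1
    refine LinearMap.ext fun x => ?_
    change φ (x.1, 0) + φ (0, x.2) = φ x
    rw [← map_add]
    congr 1
    simp

theorem isReflexive_punit : isReflexive Λ (FGModuleCat.of Λ PUnit.{u + 1}) := by
  constructor
  · intro x y _; rfl
  · intro Φ
    refine ⟨PUnit.unit, ?_⟩
    ext φ
    have h : φ = 0 := LinearMap.ext fun x => map_zero φ
    rw [h, map_zero, map_zero]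

instance : HasZeroObject (Refl Λ) where
  zero := by
    refine ⟨⟨FGModuleCat.of Λ PUnit.{u + 1}, isReflexive_punit⟩, ?_⟩
    rw [IsZero.iff_id_eq_zero]
    refine ObjectProperty.hom_ext _ (FGModuleCat.hom_ext ?_)
    ext

instance : HasBinaryBiproducts (Refl Λ) where
  has_binary_biproduct M N := by
    refine HasBinaryBiproduct.mk
      { bicone :=
          { pt := ⟨FGModuleCat.of Λ (M.obj × N.obj), isReflexive_prod M N⟩
            fst := ObjectProperty.homMk (FGModuleCat.ofHom (LinearMap.fst Λ M.obj N.obj))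
            snd := ObjectProperty.homMk (FGModuleCat.ofHom (LinearMap.snd Λ M.obj N.obj))
            inl := ObjectProperty.homMk (FGModuleCat.ofHom (LinearMap.inl Λ M.obj N.obj))
            inr := ObjectProperty.homMk (FGModuleCat.ofHom (LinearMap.inr Λ M.obj N.obj))
            inl_fst := rfl
            inl_snd := rfl
            inr_fst := rfl
            inr_snd := rfl }
        isBilimit := isBinaryBilimitOfTotal _ ?_ }
    refine ObjectProperty.hom_ext _ (FGModuleCat.hom_ext (LinearMap.ext fun x => ?_))
    change ((x.1, 0) : M.obj × N.obj) + (0, x.2) = x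
    simp

/-- The category `refl Λ` is additive. -/
instance : HasFiniteBiproducts (Refl Λ) :=
  haveI : HasFiniteProducts (Refl Λ) := hasFiniteProducts_of_has_binary_and_terminal
  HasFiniteBiproducts.of_hasFiniteProducts

end Dual

/-! ### Exact structures on additive categories -/

section Exact

variable {C : Type*} [Category C] [Preadditive C]

/-- A kernel-cokernel pair `X₁ ⟶ X₂ ⟶ X₃`: the first map is a kernel of the second one, and the
second map is a cokernel of the first one. -/
def IsKernelCokernelPair (S : ShortComplex C) : Prop :=
  Nonempty (IsLimit (KernelFork.ofι S.f S.zero)) ∧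
    Nonempty (IsColimit (CokernelCofork.ofπ S.g S.zero))

/-- Some sequence `X ⟶ Y ⟶ Z` in the class `E` has `f` as its first map. -/
def IsInflation (E : ObjectProperty (ShortComplex C)) {X Y : C} (f : X ⟶ Y) : Prop :=
  ∃ (Z : C) (g : Y ⟶ Z) (w : f ≫ g = 0), E (ShortComplex.mk f g w)

/-- Some sequence `X ⟶ Y ⟶ Z` in the class `E` has `g` as its second map. -/
def IsDeflation (E : ObjectProperty (ShortComplex C)) {Y Z : C} (g : Y ⟶ Z) : Prop :=
  ∃ (X : C) (f : X ⟶ Y) (w : f ≫ g = 0), E (ShortComplex.mk f g w)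

variable (C) in
/-- A (Quillen) exact structure on an additive category: a class of kernel-cokernel pairs, called
conflations, with the following closure properties. -/
structure ExactStructure [HasFiniteBiproducts C] where
  /-- The class of conflations. -/
  conflation : ObjectProperty (ShortComplex C)
  isKernelCokernelPair : ∀ S, conflation S → IsKernelCokernelPair S
  of_iso : ∀ S T : ShortComplex C, Nonempty (S ≅ T) → conflation S → conflation T
  id_zero : ∀ L Z : C, IsZero Z → conflation (ShortComplex.mk (𝟙 L) (0 : L ⟶ Z) comp_zero)
  zero_id : ∀ L Z : C, IsZero Z → conflation (ShortComplex.mk (0 : Z ⟶ L) (𝟙 L) zero_comp)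
  inflation_comp : ∀ {X Y Z : C} (f : X ⟶ Y) (g : Y ⟶ Z),
    IsInflation conflation f → IsInflation conflation g → IsInflation conflation (f ≫ g)
  deflation_comp : ∀ {X Y Z : C} (f : X ⟶ Y) (g : Y ⟶ Z),
    IsDeflation conflation f → IsDeflation conflation g → IsDeflation conflation (f ≫ g)
  pushout : ∀ S : ShortComplex C, conflation S → ∀ {L : C} (a : S.X₁ ⟶ L),
    ∃ (N : C) (b : S.X₂ ⟶ N) (f : L ⟶ N) (g : N ⟶ S.X₃) (w : f ≫ g = 0),
      IsPushout S.f a b f ∧ b ≫ g = S.g ∧ conflation (ShortComplex.mk f g w)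
  pullback : ∀ S : ShortComplex C, conflation S → ∀ {M : C} (c : M ⟶ S.X₃),
    ∃ (N : C) (b : N ⟶ S.X₂) (f : S.X₁ ⟶ N) (g : N ⟶ M) (w : f ≫ g = 0),
      IsPullback b g S.g c ∧ f ≫ b = S.f ∧ conflation (ShortComplex.mk f g w)

/-- An exact structure that contains every other exact structure on the category. -/
def ExactStructure.IsMaximum [HasFiniteBiproducts C] (E : ExactStructure C) : Prop :=
  ∀ E' : ExactStructure C, E'.conflation ≤ E.conflation

end Exact

end ReflConflation

open ReflConflation

/-!
In `refl Λ` both kernels and cokernels exist: the kernel is that of `mod Λ`, and the cokernel is the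
double dual of that of `mod Λ`. So a kernel-cokernel pair `L ⟶ M ⟶ N` is an injection `L → M` with
torsion-free cokernel `C` together with an isomorphism `C^** ≃ N`, and everything rests on
controlling how far `C` is from `C^**` and how far double duals are from being exact.

Strong grade at least two is used in the form `ExtendsUniquely`: `X` has this property iff every map
into `Λ` from a submodule `I ⊆ E` with `E / I ⊆ X` extends uniquely to `E`
(`two_le_strongGrade_iff`, from the long exact `Ext`-sequence). Such `X` form a Serre class
(`ExtendsUniquely.of_exact`), and if the cokernel of `X → Y` has the property, then maps from `X` to
a reflexive module that vanish on the kernel extend uniquely to `Y`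
(`ExtendsUniquely.exists_extension_reflexive`).

The `(2, 2)`-condition enters by dimension shifting (`SGradeExtCondition.extendsUniquely`): if `Y`
is the kernel of a map `F → G` of finitely generated projective modules, then `Y^* / im F^*` embeds
into `Ext²(G / im F, Λ)`. On one side this applies to `Y = X^*` and shows that `X^** / im X` has
strong grade at least two (`extendsUniquely_coker_evalMap`). On the other side it applies, after
passing to a free cover of `B`, to an exact sequence `0 → A → B → C` with `C` torsion-free, and
shows that `A^* / im B^*` has strong grade at least two (`extendsUniquely_coker_dual`). The second fact
makes `0 → A^** → B^** → C^**` exact. Hence kernels of maps from reflexive to torsion-free modules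
are reflexive, extensions of torsion-free modules are torsion-free, and pushouts of inflations are
inflations.

Consequently `L ⟶ M ⟶ N` is a kernel-cokernel pair iff `0 → L → M → N` is exact and the cokernel of
`M → N` has strong grade at least two (`isKernelCokernelPair_iff`); `f` is an inflation iff it is
injective with torsion-free cokernel, and `g` is a deflation iff its cokernel has strong grade at
least two. In these terms the axioms of an exact structure follow from the Serre property and the
left exactness just described, and a structure consisting of all kernel-cokernel pairs is maximum.
-/

namespace ReflConflation

/-! ### Strong grade at least two as unique extension of maps -/

section UniqueExtension

variable {R : Type u} [Ring R] {U : Type u} [AddCommGroup U] [Module R U]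

variable (R U) in
/-- Every linear map into `U` from the kernel of a linear map `θ : E → X` extends uniquely to `E`.
As `E / ker θ` runs over all submodules of `X`, this says that `Hom` and `Ext¹` into `U` vanish on
all submodules of `X`; see `two_le_strongGrade_iff`. -/
def ExtendsUniquely (X : Type u) [AddCommGroup X] [Module R X] : Prop :=
  ∀ (E : Type u) [AddCommGroup E] [Module R E] (θ : E →ₗ[R] X) (ψ : LinearMap.ker θ →ₗ[R] U),
    ∃! Ψ : E →ₗ[R] U, Ψ ∘ₗ (LinearMap.ker θ).subtype = ψ

theorem two_le_strongGrade_iff_subsingleton (X : Type u) [AddCommGroup X] [Module R X] :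
    2 ≤ strongGrade R U X ↔ ∀ N : Submodule R X,
      Subsingleton (Ext (ModuleCat.of R N) (ModuleCat.of R U) 0) ∧
        Subsingleton (Ext (ModuleCat.of R N) (ModuleCat.of R U) 1) := by
  simp only [strongGrade, le_iInf_iff]
  constructor
  · intro h N
    have key : ∀ n : ℕ, n < 2 →
        Subsingleton (Ext (ModuleCat.of R N) (ModuleCat.of R U) n) := by
      intro n hn
      by_contra hN
      rw [not_subsingleton_iff_nontrivial] at hN
      have := h n ⟨N, hN⟩
      have : (2 : ℕ) ≤ n := by exact_mod_cast this
      omega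
    exact ⟨key 0 (by norm_num), key 1 (by norm_num)⟩
  · rintro h n ⟨N, hN⟩
    have h0 : n ≠ 0 := by
      rintro rfl
      exact not_subsingleton_iff_nontrivial.2 hN (h N).1
    have h1 : n ≠ 1 := by
      rintro rfl
      exact not_subsingleton_iff_nontrivial.2 hN (h N).2
    have : 2 ≤ n := by omega
    exact_mod_cast this

/-- The long exact `Ext`-sequence of `0 → I → E → N → 0`, in low degrees. -/
theorem existsUnique_extension_of_subsingleton_ext {I E N : Type u} [AddCommGroup I] [Module R I]
    [AddCommGroup E] [Module R E] [AddCommGroup N] [Module R N] {i : I →ₗ[R] E} {p : E →ₗ[R] N}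
    (hi : Function.Injective i) (hip : Function.Exact i p) (hp : Function.Surjective p)
    [Subsingleton (Ext (ModuleCat.of R N) (ModuleCat.of R U) 0)]
    [Subsingleton (Ext (ModuleCat.of R N) (ModuleCat.of R U) 1)] (ψ : I →ₗ[R] U) :
    ∃! Ψ : E →ₗ[R] U, Ψ ∘ₗ i = ψ := by
  let S := ModuleCat.shortComplexOfCompEqZero i p hip.linearMap_comp_eq_zero
  have hS : S.ShortExact := ModuleCat.shortComplex_shortExact S hip hi hp
  obtain ⟨x, hx⟩ := Ext.contravariant_sequence_exact₁ hS (ModuleCat.of R U)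
    (Ext.mk₀ (ModuleCat.ofHom ψ)) (n₁ := 1) rfl
    (Subsingleton.elim (α := Ext (ModuleCat.of R N) _ 1) _ _)
  obtain ⟨Ψ, rfl⟩ := (Ext.mk₀_bijective _ _).2 x
  rw [Ext.mk₀_comp_mk₀] at hx
  have hΨ : Ψ.hom ∘ₗ i = ψ := congrArg ModuleCat.Hom.hom ((Ext.mk₀_bijective _ _).1 hx)
  refine ⟨Ψ.hom, hΨ, fun Ψ' h' => ?_⟩
  obtain ⟨y, hy⟩ := Ext.contravariant_sequence_exact₂ hS (Y := ModuleCat.of R U)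
    (Ext.mk₀ (ModuleCat.ofHom (Ψ' - Ψ.hom))) (by
      rw [Ext.mk₀_comp_mk₀, Ext.mk₀_eq_zero_iff]
      refine ModuleCat.hom_ext ?_
      change (Ψ' - Ψ.hom) ∘ₗ i = 0
      rw [LinearMap.sub_comp, h', hΨ, sub_self])
  rw [Subsingleton.elim (α := Ext (ModuleCat.of R N) _ 0) y 0, Ext.comp_zero, eq_comm,
    Ext.mk₀_eq_zero_iff] at hy
  exact sub_eq_zero.1 (congrArg ModuleCat.Hom.hom hy)

theorem two_le_strongGrade_iff (X : Type u) [AddCommGroup X] [Module R X] :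
    2 ≤ strongGrade R U X ↔ ExtendsUniquely R U X := by
  rw [two_le_strongGrade_iff_subsingleton]
  constructor
  · intro h E _ _ θ ψ
    have := (h (LinearMap.range θ)).1
    have := (h (LinearMap.range θ)).2
    refine existsUnique_extension_of_subsingleton_ext (p := θ.rangeRestrict)
      Subtype.val_injective ?_ θ.surjective_rangeRestrict ψ
    rw [LinearMap.exact_iff, LinearMap.ker_rangeRestrict, Submodule.range_subtype]
  · intro h N
    constructor
    · refine ⟨fun x y => ?_⟩
      obtain ⟨x, rfl⟩ := (Ext.mk₀_bijective _ _).2 x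
      obtain ⟨y, rfl⟩ := (Ext.mk₀_bijective _ _).2 y
      congr 1
      refine ModuleCat.hom_ext ((h N N.subtype 0).unique ?_ ?_) <;>
      · refine LinearMap.ext fun z => ?_
        have hz : (z : N) = 0 := Subtype.ext z.2
        simp [hz]
    · refine subsingleton_of_forall_eq 0 fun e => ?_
      -- a class in `Ext¹` comes from a map on the kernel of a free cover, and that map extends
      let p : (N →₀ R) →ₗ[R] N := Finsupp.linearCombination R id
      have hp : Function.Surjective p := Finsupp.linearCombination_id_surjective R N
      let S := ModuleCat.shortComplexOfCompEqZero (M := LinearMap.ker p) (LinearMap.ker p).subtype p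
        p.comp_ker_subtype
      have hS : S.ShortExact := ModuleCat.shortComplex_shortExact S
        (LinearMap.exact_subtype_ker_map p) Subtype.val_injective hp
      have : Projective S.X₂ := ModuleCat.projective_of_categoryTheory_projective _
      obtain ⟨y, rfl⟩ := Ext.contravariant_sequence_exact₃ hS (ModuleCat.of R U) e
        (Ext.eq_zero_of_projective _) (n₀ := 0) rfl
      obtain ⟨ψ, rfl⟩ := (Ext.mk₀_bijective _ _).2 y
      obtain ⟨Ψ, hΨ, -⟩ := h (N →₀ R) (N.subtype ∘ₗ p) (ψ.hom ∘ₗ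
        LinearMap.codRestrict (LinearMap.ker p) (LinearMap.ker (N.subtype ∘ₗ p)).subtype
          fun x => Subtype.ext x.2)
      have : Ext.mk₀ ψ = (Ext.mk₀ S.f).comp (Ext.mk₀ (ModuleCat.ofHom Ψ)) (zero_add 0) := by
        rw [Ext.mk₀_comp_mk₀]
        congr 1
        refine ModuleCat.hom_ext (LinearMap.ext fun x => ?_)
        have hx : (x : N →₀ R) ∈ LinearMap.ker (N.subtype ∘ₗ p) := congrArg Subtype.val x.2
        exact (LinearMap.congr_fun hΨ ⟨x, hx⟩).symm
      rw [this, ShortComplex.ShortExact.extClass_comp_assoc]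

namespace ExtendsUniquely

variable {X Y Z : Type u} [AddCommGroup X] [Module R X] [AddCommGroup Y] [Module R Y]
  [AddCommGroup Z] [Module R Z]

theorem of_subsingleton [Subsingleton X] : ExtendsUniquely R U X := by
  intro E _ _ θ ψ
  have h : ∀ x, x ∈ LinearMap.ker θ := fun x => Subsingleton.elim _ _
  refine ⟨ψ ∘ₗ LinearMap.codRestrict _ LinearMap.id h, rfl, fun Ψ hΨ => ?_⟩
  ext x
  exact LinearMap.congr_fun hΨ ⟨x, h x⟩

theorem eq_zero (hX : ExtendsUniquely R U X) {E : Type u} [AddCommGroup E] [Module R E]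
    (θ : E →ₗ[R] X) {Ψ : E →ₗ[R] U} (h : ∀ x, θ x = 0 → Ψ x = 0) : Ψ = 0 :=
  (hX E θ 0).unique (LinearMap.ext fun x => h x x.2) (LinearMap.zero_comp _)

/-- Maps into `U` that agree on the image of `q` are equal if maps extend uniquely along the
cokernel of `q`. -/
theorem hom_ext {q : X →ₗ[R] Y} (hq : ExtendsUniquely R U (Y ⧸ LinearMap.range q))
    {Ψ Ψ' : Y →ₗ[R] U} (h : ∀ x, Ψ (q x) = Ψ' (q x)) : Ψ = Ψ' := by
  refine sub_eq_zero.1 (hq.eq_zero (LinearMap.range q).mkQ fun y hy => ?_)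
  obtain ⟨x, rfl⟩ := (Submodule.Quotient.mk_eq_zero _).1 hy
  exact sub_eq_zero.2 (h x)

/-- A map into `U` that vanishes on `ker q` extends along `q` to its codomain. -/
theorem exists_extension {q : X →ₗ[R] Y} (hq : ExtendsUniquely R U (Y ⧸ LinearMap.range q))
    (ψ : X →ₗ[R] U) (h : ∀ x, q x = 0 → ψ x = 0) : ∃ Ψ : Y →ₗ[R] U, Ψ ∘ₗ q = ψ := by
  have hk : LinearMap.ker (LinearMap.range q).mkQ = LinearMap.range q := Submodule.ker_mkQ _
  let r : LinearMap.range q →ₗ[R] U :=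
    (LinearMap.ker q).liftQ ψ h ∘ₗ q.quotKerEquivRange.symm.toLinearMap
  obtain ⟨Ψ, hΨ, -⟩ := hq Y (LinearMap.range q).mkQ (r ∘ₗ (LinearEquiv.ofEq _ _ hk).toLinearMap)
  refine ⟨Ψ, LinearMap.ext fun x => ?_⟩
  refine (LinearMap.congr_fun hΨ ⟨q x, hk.symm ▸ ⟨x, rfl⟩⟩).trans ?_
  change (LinearMap.ker q).liftQ ψ h (q.quotKerEquivRange.symm ⟨q x, ⟨x, rfl⟩⟩) = ψ x
  rw [q.quotKerEquivRange_symm_apply_image x ⟨x, rfl⟩]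
  rfl

/-- Modules along which maps extend uniquely form a Serre class. -/
theorem of_exact (hX : ExtendsUniquely R U X) (hZ : ExtendsUniquely R U Z) (a : X →ₗ[R] Y)
    (b : Y →ₗ[R] Z) (hab : Function.Exact a b) : ExtendsUniquely R U Y := by
  intro E _ _ θ ψ
  -- the fibre product of `X` and the preimage of `ker b` over `Y`; it maps onto that preimage
  let F : Submodule R (E × X) := LinearMap.ker (θ.coprod (-a))
  have hF : ∀ z : F, θ z.1.1 = a z.1.2 := fun z => by
    have := z.2
    rwa [LinearMap.mem_ker, LinearMap.coprod_apply, LinearMap.neg_apply, ← sub_eq_add_neg,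
      sub_eq_zero] at this
  have memF : ∀ e x, θ e = a x → (e, x) ∈ F := fun e x h => by
    rw [LinearMap.mem_ker, LinearMap.coprod_apply, LinearMap.neg_apply, h, add_neg_cancel]
  let fst : F →ₗ[R] LinearMap.ker (b ∘ₗ θ) :=
    LinearMap.codRestrict _ (LinearMap.fst R E X ∘ₗ F.subtype) fun z => by
      change b (θ z.1.1) = 0
      rw [hF, hab.apply_apply_eq_zero]
  let snd : F →ₗ[R] X := LinearMap.snd R E X ∘ₗ F.subtype
  have fst_surj : Function.Surjective fst := fun e => by
    obtain ⟨x, hx⟩ := (hab _).1 (show b (θ e) = 0 from e.2)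
    exact ⟨⟨(e, x), memF _ _ hx.symm⟩, rfl⟩
  have snd_ker : ∀ z, snd z = 0 → θ z.1.1 = 0 := fun z hz => by
    rw [hF]
    exact (congrArg a hz).trans (map_zero a)
  refine existsUnique_of_exists_of_unique ?_ fun Ψ Ψ' h h' => ?_
  · obtain ⟨χ, hχ, -⟩ := hX F snd (ψ ∘ₗ LinearMap.codRestrict (LinearMap.ker θ)
      ((LinearMap.ker (b ∘ₗ θ)).subtype ∘ₗ fst ∘ₗ (LinearMap.ker snd).subtype)
      fun z => snd_ker z z.2)
    have hχ0 : ∀ z, fst z = 0 → χ z = 0 := fun z hz => by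
      have h0 : χ ∘ₗ (LinearMap.ker fst).subtype = 0 := by
        refine hX.eq_zero (E := LinearMap.ker fst) (snd ∘ₗ (LinearMap.ker fst).subtype)
          fun w hw => ?_
        have hw' : (w : F) = 0 :=
          Subtype.ext (Prod.ext (congrArg Subtype.val (show fst w = 0 from w.2)) hw)
        change χ w = 0
        rw [hw', map_zero]
      exact LinearMap.congr_fun h0 ⟨z, hz⟩
    let χ' : LinearMap.ker (b ∘ₗ θ) →ₗ[R] U := (LinearMap.ker fst).liftQ χ hχ0 ∘ₗ
      (fst.quotKerEquivOfSurjective fst_surj).symm.toLinearMap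
    have hχ' : ∀ z, χ' (fst z) = χ z := fun z => by
      have : (fst.quotKerEquivOfSurjective fst_surj).symm (fst z) = Submodule.Quotient.mk z := by
        rw [LinearEquiv.symm_apply_eq]
        rfl
      change (LinearMap.ker fst).liftQ χ hχ0 _ = _
      erw [this]
      rfl
    obtain ⟨Ψ, hΨ, -⟩ := hZ E (b ∘ₗ θ) χ'
    refine ⟨Ψ, LinearMap.ext fun e => ?_⟩
    have he : θ e = 0 := e.2
    let z : F := ⟨(e, 0), memF _ _ (by rw [he, map_zero])⟩
    have h1 : Ψ e = χ z := (LinearMap.congr_fun hΨ (fst z)).trans (hχ' z)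
    exact h1.trans (LinearMap.congr_fun hχ ⟨z, rfl⟩)
  · refine sub_eq_zero.1 (hZ.eq_zero (b ∘ₗ θ) fun e he => ?_)
    obtain ⟨z, hz⟩ := fst_surj ⟨e, he⟩
    have h0 : (Ψ - Ψ') ∘ₗ (LinearMap.ker (b ∘ₗ θ)).subtype ∘ₗ fst = 0 := by
      refine hX.eq_zero snd fun w hw => ?_
      refine (sub_eq_zero.2 ?_ : Ψ w.1.1 - Ψ' w.1.1 = 0)
      exact LinearMap.congr_fun (h.trans h'.symm) ⟨w.1.1, snd_ker w hw⟩
    have := LinearMap.congr_fun h0 z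
    change (Ψ - Ψ') (fst z).1 = 0 at this
    rwa [hz] at this

theorem of_injective (hY : ExtendsUniquely R U Y) (f : X →ₗ[R] Y) (hf : Function.Injective f) :
    ExtendsUniquely R U X :=
  of_exact (of_subsingleton (X := PUnit)) hY 0 f fun x =>
    ⟨fun h => ⟨0, (hf (h.trans (map_zero f).symm)).symm⟩, by rintro ⟨_, rfl⟩; exact map_zero f⟩

theorem of_surjective (hX : ExtendsUniquely R U X) (f : X →ₗ[R] Y)
    (hf : Function.Surjective f) : ExtendsUniquely R U Y :=
  of_exact hX (of_subsingleton (X := PUnit)) f 0 fun y => ⟨fun _ => hf y, fun _ => rfl⟩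

end ExtendsUniquely

end UniqueExtension

/-! ### Second `Ext` and restriction of functionals to second syzygies -/

section Syzygy

variable (A B : Type u) [Ring A] [Ring B] (U : Type u) [AddCommGroup U] [Module A U] [Module B U]
  [SMulCommClass B A U] [SMulCommClass A B U]

/-- Dimension shifting: if `0 → Y → F → G` is exact with `F` and `G` projective, then
`Hom(Y, U)` modulo the restrictions of maps on `F` embeds into `Ext²(G / im F, U)`, for every
module structure on `U` that commutes with the given one. -/
theorem exists_linearMap_ext_two {Y F G : Type u} [AddCommGroup Y] [Module A Y] [AddCommGroup F]
    [Module A F] [AddCommGroup G] [Module A G] [Module.Projective A F] [Module.Projective A G]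
    (i : Y →ₗ[A] F) (d : F →ₗ[A] G) (hi : Function.Injective i) (hid : Function.Exact i d) :
    letI := extModule A B U (ModuleCat.of A (G ⧸ LinearMap.range d)) 2
    ∃ θ : (Y →ₗ[A] U) →ₗ[B] Ext (ModuleCat.of A (G ⧸ LinearMap.range d)) (ModuleCat.of A U) 2,
      LinearMap.ker θ = LinearMap.range (LinearMap.lcomp B U i) := by
  let := extModule A B U (ModuleCat.of A (G ⧸ LinearMap.range d)) 2
  have h₁ : Function.Exact i d.rangeRestrict := by
    rw [LinearMap.exact_iff, LinearMap.ker_rangeRestrict, hid.linearMap_ker_eq]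
  let S₁ := ModuleCat.shortComplexOfCompEqZero i d.rangeRestrict h₁.linearMap_comp_eq_zero
  have hS₁ : S₁.ShortExact := ModuleCat.shortComplex_shortExact S₁ h₁ hi
    d.surjective_rangeRestrict
  have h₂ : Function.Exact (LinearMap.range d).subtype (LinearMap.range d).mkQ := by
    rw [LinearMap.exact_iff, Submodule.ker_mkQ, Submodule.range_subtype]
  let S₂ := ModuleCat.shortComplexOfCompEqZero (M := LinearMap.range d) (LinearMap.range d).subtype
    (LinearMap.range d).mkQ h₂.linearMap_comp_eq_zero
  have hS₂ : S₂.ShortExact := ModuleCat.shortComplex_shortExact S₂ h₂ Subtype.val_injective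
    (Submodule.mkQ_surjective _)
  have : Projective S₁.X₂ := ModuleCat.projective_of_categoryTheory_projective _
  have : Projective S₂.X₂ := ModuleCat.projective_of_categoryTheory_projective _
  -- the composite of the connecting maps `Hom(Y, U) → Ext¹(im d, U) → Ext²(G / im d, U)`, of which
  -- the second is injective because `Ext¹(G, U) = 0`
  let θ : (Y →ₗ[A] U) →ₗ[B]
      Ext (ModuleCat.of A (G ⧸ LinearMap.range d)) (ModuleCat.of A U) 2 :=
    { toFun := fun φ => (hS₂.extClass.comp (hS₁.extClass.comp
        (Ext.mk₀ (ModuleCat.ofHom φ) : Ext S₁.X₁ (ModuleCat.of A U) 0) (add_zero 1)) (by norm_num :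
          1 + 1 = 2) : Ext S₂.X₃ (ModuleCat.of A U) 2)
      map_add' := fun φ ψ => by
        rw [ModuleCat.ofHom_add, Ext.mk₀_add, Ext.comp_add, Ext.comp_add]
      map_smul' := fun b φ => by
        have h : ModuleCat.ofHom (b • φ) =
          ModuleCat.ofHom φ ≫ ModuleCat.ofHom (DistribSMul.toLinearMap A U b) := rfl
        rw [h, ← Ext.mk₀_comp_mk₀]
        change _ = (Ext.comp _ _ _).comp (Ext.mk₀ _) (add_zero 2)
        rw [Ext.comp_assoc_of_third_deg_zero, Ext.comp_assoc_of_third_deg_zero] }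
  refine ⟨θ, Submodule.ext fun φ => ⟨fun hφ => ?_, ?_⟩⟩
  · obtain ⟨x, hx⟩ := Ext.contravariant_sequence_exact₁ hS₂ (ModuleCat.of A U) _ (rfl : 1 + 1 = 2)
      (show θ φ = 0 from hφ)
    rw [Ext.eq_zero_of_projective x, Ext.comp_zero] at hx
    obtain ⟨y, hy⟩ := Ext.contravariant_sequence_exact₁ hS₁ (ModuleCat.of A U) _ (add_zero 1)
      hx.symm
    obtain ⟨χ, rfl⟩ := (Ext.mk₀_bijective _ _).2 y
    rw [Ext.mk₀_comp_mk₀] at hy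
    exact ⟨χ.hom, congrArg ModuleCat.Hom.hom ((Ext.mk₀_bijective _ _).1 hy)⟩
  · rintro ⟨χ, rfl⟩
    have h : (Ext.mk₀ (ModuleCat.ofHom (LinearMap.lcomp B U i χ)) :
        Ext S₁.X₁ (ModuleCat.of A U) 0) =
          (Ext.mk₀ S₁.f).comp (Ext.mk₀ (ModuleCat.ofHom χ)) (zero_add 0) := by
      rw [Ext.mk₀_comp_mk₀]
      rfl
    change hS₂.extClass.comp (hS₁.extClass.comp (Ext.mk₀ _) (add_zero 1))
      (by norm_num : 1 + 1 = 2) = 0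
    rw [h, ShortComplex.ShortExact.extClass_comp_assoc, Ext.comp_zero]

variable {A B U}

/-- Under the `(2, 2)`-condition, functionals on a submodule `Y` of a projective module `F` that is
the kernel of a map to a projective module are, up to a module of strong grade at least two,
restrictions of functionals on `F`. -/
theorem SGradeExtCondition.extendsUniquely (h : SGradeExtCondition A B U 2 2)
    {Y F G : Type u} [AddCommGroup Y] [Module A Y] [AddCommGroup F]
    [Module A F] [AddCommGroup G] [Module A G] [Module.Projective A F] [Module.Projective A G]
    [Module.Finite A G] (i : Y →ₗ[A] F) (d : F →ₗ[A] G) (hi : Function.Injective i)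
    (hid : Function.Exact i d) :
    ExtendsUniquely B U ((Y →ₗ[A] U) ⧸ LinearMap.range (LinearMap.lcomp B U i)) := by
  let := extModule A B U (ModuleCat.of A (G ⧸ LinearMap.range d)) 2
  obtain ⟨θ, hθ⟩ := exists_linearMap_ext_two A B U i d hi hid
  have hE : ExtendsUniquely B U
      (Ext (ModuleCat.of A (G ⧸ LinearMap.range d)) (ModuleCat.of A U) 2) :=
    (two_le_strongGrade_iff _).1
      (h (ModuleCat.of A (G ⧸ LinearMap.range d)) (inferInstanceAs (Module.Finite A (_ ⧸ _))))
  refine hE.of_injective ((LinearMap.range (LinearMap.lcomp B U i)).liftQ θ hθ.ge) ?_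
  rw [← LinearMap.ker_eq_bot]
  exact Submodule.ker_liftQ_eq_bot _ _ _ hθ.le

end Syzygy

/-! ### Duals of finitely generated modules -/

section FiniteDual

theorem isNoetherian_linearMap {A B U X : Type*} [Ring A] [Ring B] [AddCommGroup U] [Module A U]
    [Module B U] [SMulCommClass A B U] [IsNoetherian B U] [AddCommGroup X] [Module A X]
    [Module.Finite A X] : IsNoetherian B (X →ₗ[A] U) := by
  obtain ⟨n, s, hs⟩ := Module.Finite.exists_fin (R := A) (M := X)
  let e : (X →ₗ[A] U) →ₗ[B] (Fin n → U) :=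
    { toFun := fun φ k => φ (s k)
      map_add' := fun _ _ => rfl
      map_smul' := fun _ _ => rfl }
  refine isNoetherian_of_injective e fun φ ψ h => ?_
  exact LinearMap.ext_on_range hs fun k => congrFun h k

variable (Λ : Type u) [Ring Λ]

/-- The identity map as an isomorphism between `Λ`, as a right module over itself, and the regular
left module of `Λᵐᵒᵖ`. -/
def rightRegularEquiv : Λ ≃ₗ[Λᵐᵒᵖ] Λᵐᵒᵖ :=
  { MulOpposite.opAddEquiv with map_smul' := fun _ _ => rfl }

theorem isNoetherian_right [IsNoetherianRing Λᵐᵒᵖ] : IsNoetherian Λᵐᵒᵖ Λ :=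
  isNoetherian_of_linearEquiv (rightRegularEquiv Λ).symm

theorem free_right : Module.Free Λᵐᵒᵖ Λ :=
  Module.Free.of_equiv (rightRegularEquiv Λ).symm

theorem finite_right : Module.Finite Λᵐᵒᵖ Λ :=
  Module.Finite.equiv (rightRegularEquiv Λ).symm

/-- The dual of a free left module of finite rank is the free right module of that rank. -/
noncomputable def dualFreeEquiv (n : ℕ) : (Fin n → Λ) ≃ₗ[Λᵐᵒᵖ] Dual Λ (Fin n → Λ) :=
  (Pi.basisFun Λ (Fin n)).constr Λᵐᵒᵖ

variable (X : Type u) [AddCommGroup X] [Module Λ X] [Module.Finite Λ X]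

theorem finite_dual [IsNoetherianRing Λᵐᵒᵖ] : Module.Finite Λᵐᵒᵖ (Dual Λ X) :=
  have := isNoetherian_right Λ
  have : IsNoetherian Λᵐᵒᵖ (Dual Λ X) := isNoetherian_linearMap
  inferInstance

theorem finite_doubleDual [IsNoetherianRing Λ] [IsNoetherianRing Λᵐᵒᵖ] :
    Module.Finite Λ (DoubleDual Λ X) :=
  have := finite_dual Λ X
  have : IsNoetherian Λ (DoubleDual Λ X) := isNoetherian_linearMap
  inferInstance

theorem evalMap_free_surjective (n : ℕ) : Function.Surjective (evalMap Λ (Fin n → Λ)) := by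
  intro Φ
  refine ⟨fun k => Φ (LinearMap.proj k), LinearMap.ext fun φ => ?_⟩
  have hφ : φ = ∑ k, MulOpposite.op (φ (Pi.single k 1)) •
      (LinearMap.proj k : (Fin n → Λ) →ₗ[Λ] Λ) := by
    refine LinearMap.pi_ext' fun j => LinearMap.ext_ring ?_
    simp [Pi.single_apply]
  conv_rhs => rw [hφ]
  conv_lhs => rw [hφ]
  simp only [map_sum, map_smul]
  rfl

end FiniteDual

/-! ### Consequences of the `(2, 2)`-condition for duals -/

section Condition

variable {Λ : Type u} [Ring Λ]

theorem IsTorsionFree.eq_zero {X : Type u} [AddCommGroup X] [Module Λ X] (h : IsTorsionFree Λ X)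
    {x : X} (hx : ∀ φ : Dual Λ X, φ x = 0) : x = 0 :=
  h (LinearMap.ext fun φ => (hx φ).trans (map_zero φ).symm)

theorem isTorsionFree_of_forall {X : Type u} [AddCommGroup X] [Module Λ X]
    (h : ∀ x : X, (∀ φ : Dual Λ X, φ x = 0) → x = 0) : IsTorsionFree Λ X :=
  (injective_iff_map_eq_zero _).2 fun x hx => h x fun φ => LinearMap.congr_fun hx φ

theorem IsTorsionFree.of_injective {X Y : Type u} [AddCommGroup X] [Module Λ X] [AddCommGroup Y]
    [Module Λ Y] (h : IsTorsionFree Λ Y) (f : X →ₗ[Λ] Y) (hf : Function.Injective f) :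
    IsTorsionFree Λ X :=
  isTorsionFree_of_forall fun _ hx =>
    (map_eq_zero_iff f hf).1 (h.eq_zero fun φ => hx (φ ∘ₗ f))

/-- The cokernel of `X → X^**` is the second `Ext` of the transpose of `X`: it is
`Hom(X^*, Λ)` modulo functionals on the dual of a free cover of `X`, and `X^*` is the kernel of the
dual of a free presentation of `X`. -/
theorem extendsUniquely_coker_evalMap [IsNoetherianRing Λ]
    (hΛ : SGradeExtCondition Λᵐᵒᵖ Λ Λ 2 2) (X : Type u) [AddCommGroup X] [Module Λ X]
    [Module.Finite Λ X] :
    ExtendsUniquely Λ Λ (DoubleDual Λ X ⧸ LinearMap.range (evalMap Λ X)) := by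
  obtain ⟨n, s, hs⟩ := Module.Finite.exists_fin' Λ X
  obtain ⟨m, r, hr⟩ := Module.Finite.exists_fin' Λ (LinearMap.ker s)
  have := free_right Λ
  have := finite_right Λ
  have (k : ℕ) : Module.Projective Λᵐᵒᵖ (Dual Λ (Fin k → Λ)) :=
    Module.Projective.of_equiv (dualFreeEquiv Λ k)
  have (k : ℕ) : Module.Finite Λᵐᵒᵖ (Dual Λ (Fin k → Λ)) :=
    Module.Finite.equiv (dualFreeEquiv Λ k)
  have key := hΛ.extendsUniquely (LinearMap.lcomp Λᵐᵒᵖ Λ s)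
    (LinearMap.lcomp Λᵐᵒᵖ Λ ((LinearMap.ker s).subtype ∘ₗ r))
    (fun φ ψ h => LinearMap.ext fun x => by
      obtain ⟨y, rfl⟩ := hs x
      exact LinearMap.congr_fun h y)
    (fun φ => ⟨fun h => by
      have hφ : LinearMap.ker s ≤ LinearMap.ker φ := fun y hy => by
        obtain ⟨z, hz⟩ := hr ⟨y, hy⟩
        have := LinearMap.congr_fun h z
        change φ (r z) = 0 at this
        rwa [hz] at this
      refine ⟨(LinearMap.ker s).liftQ φ hφ ∘ₗ
        (s.quotKerEquivOfSurjective hs).symm.toLinearMap, LinearMap.ext fun y => ?_⟩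
      have hy : (s.quotKerEquivOfSurjective hs).symm (s y) = Submodule.Quotient.mk y := by
        rw [LinearEquiv.symm_apply_eq]
        rfl
      change (LinearMap.ker s).liftQ φ hφ ((s.quotKerEquivOfSurjective hs).symm (s y)) = φ y
      rw [hy]
      rfl,
      by
        rintro ⟨ψ, rfl⟩
        refine LinearMap.ext fun z => ?_
        exact (congrArg ψ (r z).2).trans (map_zero ψ)⟩)
  have hle : LinearMap.range (LinearMap.lcomp Λ Λ (LinearMap.lcomp Λᵐᵒᵖ Λ s)) ≤
      LinearMap.range (evalMap Λ X) := by
    rintro _ ⟨Φ, rfl⟩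
    obtain ⟨y, rfl⟩ := evalMap_free_surjective Λ n Φ
    exact ⟨s y, rfl⟩
  exact key.of_surjective (Submodule.factor hle) (Submodule.factor_surjective hle)

/-- For an exact sequence `0 → A → B → C` with `C` torsion-free, the cokernel of `B^* → A^*` embeds
into `Ext¹` of a torsion-free module, hence into the `Ext²` of a finitely generated module. -/
theorem extendsUniquely_coker_dual [IsNoetherianRing Λᵐᵒᵖ]
    (hΛ : SGradeExtCondition Λ Λᵐᵒᵖ Λ 2 2) {A B C : Type u} [AddCommGroup A] [Module Λ A]
    [AddCommGroup B] [Module Λ B] [AddCommGroup C] [Module Λ C] [Module.Finite Λ B]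
    (hC : IsTorsionFree Λ C) (i : A →ₗ[Λ] B) (p : B →ₗ[Λ] C) (hi : Function.Injective i)
    (hip : Function.Exact i p) :
    ExtendsUniquely Λᵐᵒᵖ Λ (Dual Λ A ⧸ LinearMap.range (LinearMap.lcomp Λᵐᵒᵖ Λ i)) := by
  obtain ⟨n, s, hs⟩ := Module.Finite.exists_fin' Λ B
  -- finitely many functionals on `B` that cut out the image of `A`
  have := isNoetherian_right Λ
  have : IsNoetherian Λᵐᵒᵖ (Dual Λ B) := isNoetherian_linearMap
  obtain ⟨m, δ, hδ⟩ :=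
    Module.Finite.exists_fin (R := Λᵐᵒᵖ) (M := LinearMap.ker (LinearMap.lcomp Λᵐᵒᵖ Λ i))
  let d : B →ₗ[Λ] (Fin m → Λ) := LinearMap.pi fun k => (δ k).1
  have hd : ∀ b, d b = 0 → ∃ a, i a = b := fun b hb => by
    refine (hip b).1 (hC.eq_zero fun γ => ?_)
    let D : Submodule Λᵐᵒᵖ (LinearMap.ker (LinearMap.lcomp Λᵐᵒᵖ Λ i)) :=
      LinearMap.ker (evalMap Λ B b ∘ₗ Submodule.subtype _)
    have hD : (⊤ : Submodule Λᵐᵒᵖ _) ≤ D := by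
      rw [← hδ, Submodule.span_le]
      rintro _ ⟨k, rfl⟩
      exact congrFun hb k
    have hγ : γ ∘ₗ p ∈ LinearMap.ker (LinearMap.lcomp Λᵐᵒᵖ Λ i) :=
      LinearMap.ext fun a => (congrArg γ (hip.apply_apply_eq_zero a)).trans (map_zero γ)
    exact hD (Submodule.mem_top (x := ⟨γ ∘ₗ p, hγ⟩))
  have key := hΛ.extendsUniquely (LinearMap.ker (d ∘ₗ s)).subtype (d ∘ₗ s)
    Subtype.val_injective (LinearMap.exact_subtype_ker_map _)
  let q : LinearMap.ker (d ∘ₗ s) →ₗ[Λ] A := (LinearEquiv.ofInjective i hi).symm.toLinearMap ∘ₗ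
    LinearMap.codRestrict (LinearMap.range i) (s ∘ₗ (LinearMap.ker (d ∘ₗ s)).subtype)
      fun y => hd _ y.2
  have hq : ∀ y, i (q y) = s y := fun y =>
    congrArg Subtype.val ((LinearEquiv.ofInjective i hi).apply_symm_apply ⟨s y, hd _ y.2⟩)
  have hdi : ∀ a, d (i a) = 0 := fun a => funext fun k => LinearMap.congr_fun (δ k).2 a
  let ρ := Submodule.mapQ (LinearMap.range (LinearMap.lcomp Λᵐᵒᵖ Λ i))
    (LinearMap.range (LinearMap.lcomp Λᵐᵒᵖ Λ (LinearMap.ker (d ∘ₗ s)).subtype))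
    (LinearMap.lcomp Λᵐᵒᵖ Λ q) (by
      rintro _ ⟨φ, rfl⟩
      exact ⟨φ ∘ₗ s, LinearMap.ext fun y => congrArg φ (hq y).symm⟩)
  refine key.of_injective ρ ((injective_iff_map_eq_zero _).2 fun x hx => ?_)
  obtain ⟨φ, rfl⟩ := Submodule.Quotient.mk_surjective _ x
  obtain ⟨χ, hχ⟩ := (Submodule.Quotient.mk_eq_zero _).1
    (show Submodule.Quotient.mk (LinearMap.lcomp Λᵐᵒᵖ Λ q φ) = 0 from hx)
  have hχ' : ∀ y (hy : d (s y) = 0), χ y = φ (q ⟨y, hy⟩) :=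
    fun y hy => LinearMap.congr_fun hχ ⟨y, hy⟩
  -- a functional on the free cover of `B` that restricts to `φ` descends to `B`
  have hχ0 : LinearMap.ker s ≤ LinearMap.ker χ := fun y hy => by
    have hy0 : s y = 0 := hy
    have hy' : d (s y) = 0 := by rw [hy0, map_zero]
    have : q ⟨y, hy'⟩ = 0 := (map_eq_zero_iff i hi).1 ((hq _).trans hy0)
    rw [LinearMap.mem_ker, hχ' y hy', this, map_zero]
  refine (Submodule.Quotient.mk_eq_zero _).2 ⟨(LinearMap.ker s).liftQ χ hχ0 ∘ₗ
    (s.quotKerEquivOfSurjective hs).symm.toLinearMap, LinearMap.ext fun a => ?_⟩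
  obtain ⟨y, hy⟩ := hs (i a)
  have hy1 : (s.quotKerEquivOfSurjective hs).symm (i a) = Submodule.Quotient.mk y := by
    rw [LinearEquiv.symm_apply_eq]
    exact hy.symm
  have hy2 : d (s y) = 0 := by rw [hy, hdi]
  change (LinearMap.ker s).liftQ χ hχ0 ((s.quotKerEquivOfSurjective hs).symm (i a)) = φ a
  rw [hy1]
  refine (hχ' y hy2).trans (congrArg φ (hi ((hq _).trans hy)))

end Condition

/-! ### Reflexive modules -/

section Reflexive

variable {Λ : Type u} [Ring Λ] {X Y T : Type u} [AddCommGroup X] [Module Λ X] [AddCommGroup Y]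
  [Module Λ Y] [AddCommGroup T] [Module Λ T]

theorem ExtendsUniquely.hom_ext_torsionFree {q : X →ₗ[Λ] Y}
    (hq : ExtendsUniquely Λ Λ (Y ⧸ LinearMap.range q)) (hT : IsTorsionFree Λ T)
    {u v : Y →ₗ[Λ] T} (h : ∀ x, u (q x) = v (q x)) : u = v := by
  refine LinearMap.ext fun y => hT (LinearMap.ext fun τ => ?_)
  have : τ ∘ₗ u = τ ∘ₗ v := hq.hom_ext fun x => congrArg τ (h x)
  exact LinearMap.congr_fun this y

/-- Extension of maps into reflexive modules: the extensions of all functionals on the target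
assemble to a map `T^* → Y^*`, whose dual restricts to `Y → T^** ≃ T`. -/
theorem ExtendsUniquely.exists_extension_reflexive {q : X →ₗ[Λ] Y}
    (hq : ExtendsUniquely Λ Λ (Y ⧸ LinearMap.range q)) (hT : Function.Bijective (evalMap Λ T))
    (h : X →ₗ[Λ] T) (hk : ∀ x, q x = 0 → h x = 0) : ∃ u : Y →ₗ[Λ] T, u ∘ₗ q = h := by
  choose ext hext using fun τ : Dual Λ T => hq.exists_extension (τ ∘ₗ h)
    fun x hx => (congrArg τ (hk x hx)).trans (map_zero τ)
  have hext' : ∀ τ x, ext τ (q x) = τ (h x) := fun τ x => LinearMap.congr_fun (hext τ) x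
  let L : Dual Λ T →ₗ[Λᵐᵒᵖ] Dual Λ Y :=
    { toFun := ext
      map_add' := fun τ τ' => hq.hom_ext fun x => by
        rw [LinearMap.add_apply, hext', hext', hext', LinearMap.add_apply]
      map_smul' := fun a τ => hq.hom_ext fun x => by
        rw [LinearMap.smul_apply, RingHom.id_apply, hext', hext', LinearMap.smul_apply] }
  refine ⟨(LinearEquiv.ofBijective _ hT).symm.toLinearMap ∘ₗ LinearMap.lcomp Λ Λ L ∘ₗ evalMap Λ Y,
    LinearMap.ext fun x => ?_⟩
  refine (LinearEquiv.ofBijective (evalMap Λ T) hT).symm_apply_eq.2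
    (LinearMap.ext fun τ : Dual Λ T => ?_)
  exact hext' τ x

variable (Λ) in
theorem isTorsionFree_doubleDual (X : Type u) [AddCommGroup X] [Module Λ X] :
    IsTorsionFree Λ (DoubleDual Λ X) :=
  isTorsionFree_of_forall fun _ hΦ => LinearMap.ext fun φ =>
    hΦ { toFun := fun Φ => Φ φ, map_add' := fun _ _ => rfl, map_smul' := fun _ _ => rfl }

/-- `X^**` is reflexive as soon as functionals on `X` extend uniquely to `X^**`: then `X^***` is
`X^*`. -/
theorem ExtendsUniquely.isReflexive_doubleDual
    (hX : ExtendsUniquely Λ Λ (DoubleDual Λ X ⧸ LinearMap.range (evalMap Λ X))) :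
    Function.Bijective (evalMap Λ (DoubleDual Λ X)) := by
  refine ⟨isTorsionFree_doubleDual Λ X, fun α => ?_⟩
  let c : Dual Λ X →ₗ[Λᵐᵒᵖ] Dual Λ (DoubleDual Λ X) :=
    { toFun := fun φ =>
        { toFun := fun Φ => Φ φ, map_add' := fun _ _ => rfl, map_smul' := fun _ _ => rfl }
      map_add' := fun φ ψ => LinearMap.ext fun Φ : DoubleDual Λ X => map_add Φ φ ψ
      map_smul' := fun a φ => LinearMap.ext fun Φ : DoubleDual Λ X => map_smul Φ a φ }
  refine ⟨α ∘ₗ c, LinearMap.ext fun t => ?_⟩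
  have ht : t = c (t ∘ₗ evalMap Λ X) := hX.hom_ext fun x => rfl
  rw [ht]
  rfl

variable {A B C : Type u} [AddCommGroup A] [Module Λ A] [AddCommGroup B] [Module Λ B]
  [AddCommGroup C] [Module Λ C] {i : A →ₗ[Λ] B} {p : B →ₗ[Λ] C}

/-- A submodule of a reflexive module with torsion-free quotient is reflexive. -/
theorem isReflexive_of_exact
    (h : ExtendsUniquely Λᵐᵒᵖ Λ (Dual Λ A ⧸ LinearMap.range (LinearMap.lcomp Λᵐᵒᵖ Λ i)))
    (hi : Function.Injective i) (hip : Function.Exact i p)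
    (hB : Function.Bijective (evalMap Λ B)) (hC : IsTorsionFree Λ C) :
    Function.Bijective (evalMap Λ A) := by
  refine ⟨IsTorsionFree.of_injective hB.1 i hi, fun Φ => ?_⟩
  obtain ⟨b, hb⟩ := hB.2 (Φ ∘ₗ LinearMap.lcomp Λᵐᵒᵖ Λ i)
  have hb' : ∀ β : Dual Λ B, β b = Φ (β ∘ₗ i) := fun β => LinearMap.congr_fun hb β
  obtain ⟨a, rfl⟩ := (hip b).1 (hC.eq_zero fun γ => (hb' (γ ∘ₗ p)).trans (by
    rw [LinearMap.comp_assoc, hip.linearMap_comp_eq_zero, LinearMap.comp_zero, map_zero]))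
  exact ⟨a, h.hom_ext hb'⟩

/-- An extension of torsion-free modules is torsion-free. -/
theorem isTorsionFree_of_exact
    (h : ExtendsUniquely Λᵐᵒᵖ Λ (Dual Λ A ⧸ LinearMap.range (LinearMap.lcomp Λᵐᵒᵖ Λ i)))
    (hip : Function.Exact i p) (hA : IsTorsionFree Λ A) (hC : IsTorsionFree Λ C) :
    IsTorsionFree Λ B := by
  refine isTorsionFree_of_forall fun b hb => ?_
  obtain ⟨a, rfl⟩ := (hip b).1 (hC.eq_zero fun γ => hb (γ ∘ₗ p))
  have : evalMap Λ A a = 0 := h.hom_ext fun β => hb β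
  rw [hA.eq_zero fun φ => LinearMap.congr_fun this φ, map_zero]

/-- Left exactness of the double dual: an element of `B^**` that is zero in `C^**` comes from
`A^**`. -/
theorem exists_evalMap_eq
    (h : ExtendsUniquely Λᵐᵒᵖ Λ (Dual Λ A ⧸ LinearMap.range (LinearMap.lcomp Λᵐᵒᵖ Λ i)))
    (hip : Function.Exact i p) (hp : Function.Surjective p) (hA : Function.Bijective (evalMap Λ A))
    (Ψ : DoubleDual Λ B) (hΨ : ∀ γ : Dual Λ C, Ψ (γ ∘ₗ p) = 0) :
    ∃ a, evalMap Λ B (i a) = Ψ := by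
  obtain ⟨Φ, hΦ⟩ := h.exists_extension Ψ fun β hβ => by
    have hker : LinearMap.ker p ≤ LinearMap.ker β := fun b hb => by
      obtain ⟨a, rfl⟩ := (hip b).1 hb
      exact LinearMap.congr_fun hβ a
    have : β = ((LinearMap.ker p).liftQ β hker ∘ₗ
        (p.quotKerEquivOfSurjective hp).symm.toLinearMap) ∘ₗ p := LinearMap.ext fun b => by
      have hb : (p.quotKerEquivOfSurjective hp).symm (p b) = Submodule.Quotient.mk b := by
        rw [LinearEquiv.symm_apply_eq]
        rfl
      change β b = (LinearMap.ker p).liftQ β hker ((p.quotKerEquivOfSurjective hp).symm (p b))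
      rw [hb]
      rfl
    rw [this]
    exact hΨ _
  obtain ⟨a, rfl⟩ := hA.2 Φ
  exact ⟨a, hΦ⟩

end Reflexive

/-! ### Kernel-cokernel pairs of reflexive modules -/

section Pairs

variable {Λ : Type u} [Ring Λ]

/-- A finitely generated reflexive module as an object of `refl Λ`. -/
abbrev Refl.of (X : Type u) [AddCommGroup X] [Module Λ X] [Module.Finite Λ X]
    (h : Function.Bijective (evalMap Λ X)) : Refl Λ :=
  ⟨FGModuleCat.of Λ X, h⟩

/-- The morphism of `refl Λ` given by a linear map. -/
abbrev Refl.ofLin {M N : Refl Λ} (f : M.obj →ₗ[Λ] N.obj) : M ⟶ N :=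
  ObjectProperty.homMk (FGModuleCat.ofHom f)

theorem Refl.hom_ext {M N : Refl Λ} {f g : M ⟶ N} (h : ∀ x, Refl.lin f x = Refl.lin g x) : f = g :=
  ObjectProperty.hom_ext _ (FGModuleCat.hom_ext (LinearMap.ext h))

theorem Refl.congr_lin {M N : Refl Λ} {f g : M ⟶ N} (h : f = g) (x : M.obj) :
    Refl.lin f x = Refl.lin g x := by rw [h]

theorem isReflexive_self : Function.Bijective (evalMap Λ Λ) := by
  refine ⟨isTorsionFree_of_forall fun x hx => hx LinearMap.id, fun Φ => ⟨Φ LinearMap.id, ?_⟩⟩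
  refine LinearMap.ext fun φ => ?_
  have hφ : φ = MulOpposite.op (φ 1) • LinearMap.id := LinearMap.ext_ring (by simp)
  change φ (Φ LinearMap.id) = Φ φ
  rw [hφ, map_smul]
  rfl

section Linear

variable {L M N : Type u} [AddCommGroup L] [Module Λ L] [AddCommGroup M] [Module Λ M]
  [AddCommGroup N] [Module Λ N] {f : L →ₗ[Λ] M} {g : M →ₗ[Λ] N}

/-- Elements of `L` are maps `Λ → L`, so injectivity and exactness can be tested on maps from the
reflexive module `Λ`. -/
theorem injective_and_exact_of_lift (hfg : ∀ x, g (f x) = 0)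
    (hu : ∀ l l' : Λ →ₗ[Λ] L, f ∘ₗ l = f ∘ₗ l' → l = l')
    (he : ∀ k : Λ →ₗ[Λ] M, g ∘ₗ k = 0 → ∃ l : Λ →ₗ[Λ] L, f ∘ₗ l = k) :
    Function.Injective f ∧ Function.Exact f g := by
  refine ⟨fun x y hxy => ?_, fun m => ⟨fun hm => ?_, ?_⟩⟩
  · have := hu (LinearMap.toSpanSingleton Λ L x) (LinearMap.toSpanSingleton Λ L y)
      (LinearMap.ext_ring (by simpa using hxy))
    simpa using LinearMap.congr_fun this 1
  · obtain ⟨l, hl⟩ := he (LinearMap.toSpanSingleton Λ M m) (LinearMap.ext_ring (by simpa using hm))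
    exact ⟨l 1, by simpa using LinearMap.congr_fun hl 1⟩
  · rintro ⟨x, rfl⟩
    exact hfg x

theorem exists_lift (hf : Function.Injective f) (hfg : Function.Exact f g) {W : Type u}
    [AddCommGroup W] [Module Λ W] (k : W →ₗ[Λ] M) (hk : ∀ x, g (k x) = 0) :
    ∃ l : W →ₗ[Λ] L, f ∘ₗ l = k :=
  ⟨(LinearEquiv.ofInjective f hf).symm.toLinearMap ∘ₗ
    LinearMap.codRestrict (LinearMap.range f) k fun x => (hfg _).1 (hk x),
    LinearMap.ext fun x => congrArg Subtype.val
      ((LinearEquiv.ofInjective f hf).apply_symm_apply ⟨k x, (hfg _).1 (hk x)⟩)⟩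

/-- The map `Coker f → N` induced by `g`. -/
abbrev cokerDesc (hfg : Function.Exact f g) : (M ⧸ LinearMap.range f) →ₗ[Λ] N :=
  (LinearMap.range f).liftQ g hfg.linearMap_ker_eq.ge

theorem cokerDesc_injective (hfg : Function.Exact f g) : Function.Injective (cokerDesc hfg) :=
  LinearMap.ker_eq_bot.1 (Submodule.ker_liftQ_eq_bot _ _ _ hfg.linearMap_ker_eq.le)

theorem extendsUniquely_coker_of_equiv {C : Type u} [AddCommGroup C] [Module Λ C]
    (h : ExtendsUniquely Λ Λ (DoubleDual Λ C ⧸ LinearMap.range (evalMap Λ C)))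
    {q : M →ₗ[Λ] C} (hq : Function.Surjective q) (e : DoubleDual Λ C ≃ₗ[Λ] N)
    (hg : g = e.toLinearMap ∘ₗ evalMap Λ C ∘ₗ q) :
    ExtendsUniquely Λ Λ (N ⧸ LinearMap.range g) := by
  have hle : LinearMap.range (evalMap Λ C) ≤ (LinearMap.range g).comap e.toLinearMap := by
    rintro _ ⟨c, rfl⟩
    obtain ⟨m, rfl⟩ := hq c
    exact ⟨m, LinearMap.congr_fun hg m⟩
  refine h.of_surjective (Submodule.mapQ _ _ e.toLinearMap hle) fun y => ?_
  obtain ⟨n, rfl⟩ := Submodule.Quotient.mk_surjective _ y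
  obtain ⟨c, rfl⟩ := e.surjective n
  exact ⟨Submodule.Quotient.mk c, rfl⟩

variable (f g) in
/-- The map `Coker f → Coker (g ∘ f)` induced by `g`. -/
abbrev cokerMap : (M ⧸ LinearMap.range f) →ₗ[Λ] (N ⧸ LinearMap.range (g ∘ₗ f)) :=
  Submodule.mapQ _ _ g (by rintro _ ⟨x, rfl⟩; exact ⟨x, rfl⟩)

variable (f g) in
theorem exact_cokerMap : Function.Exact (cokerMap f g)
    (Submodule.factor (LinearMap.range_comp_le_range f g)) := by
  intro z
  obtain ⟨z, rfl⟩ := Submodule.Quotient.mk_surjective _ z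
  constructor
  · intro hz
    obtain ⟨y, rfl⟩ := (Submodule.Quotient.mk_eq_zero _).1 hz
    exact ⟨Submodule.Quotient.mk y, rfl⟩
  · rintro ⟨y, hy⟩
    obtain ⟨y, rfl⟩ := Submodule.Quotient.mk_surjective _ y
    rw [← hy]
    exact (Submodule.Quotient.mk_eq_zero _).2 ⟨y, rfl⟩

theorem cokerMap_injective (hg : Function.Injective g) : Function.Injective (cokerMap f g) := by
  refine (injective_iff_map_eq_zero _).2 fun y hy => ?_
  obtain ⟨y, rfl⟩ := Submodule.Quotient.mk_surjective _ y
  obtain ⟨x, hx⟩ := (Submodule.Quotient.mk_eq_zero _).1 hy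
  exact (Submodule.Quotient.mk_eq_zero _).2 ⟨x, hg hx⟩

end Linear

variable {L M N : Refl Λ} {f : L ⟶ M} {g : M ⟶ N}

theorem injective_and_exact_of_isLimit (w : f ≫ g = 0)
    (h : Nonempty (IsLimit (KernelFork.ofι f w))) :
    Function.Injective (Refl.lin f) ∧ Function.Exact (Refl.lin f) (Refl.lin g) := by
  obtain ⟨h⟩ := h
  let P : Refl Λ := Refl.of Λ isReflexive_self
  refine injective_and_exact_of_lift (Refl.congr_lin w) (fun l l' hl => ?_) fun k hk => ?_
  · have : (Refl.ofLin l : P ⟶ L) = Refl.ofLin l' :=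
      Fork.IsLimit.hom_ext h (Refl.hom_ext fun x => LinearMap.congr_fun hl x)
    exact LinearMap.ext fun x => Refl.congr_lin this x
  · obtain ⟨l, hl⟩ := KernelFork.IsLimit.lift' h (Refl.ofLin k : P ⟶ M)
      (Refl.hom_ext fun x => LinearMap.congr_fun hk x)
    exact ⟨Refl.lin l, LinearMap.ext fun x => Refl.congr_lin hl x⟩

theorem injective_and_exact_of_isLimit_fgModuleCat {L M N : FGModuleCat.{u} Λ} {f : L ⟶ M}
    {g : M ⟶ N} (w : f ≫ g = 0) (h : Nonempty (IsLimit (KernelFork.ofι f w))) :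
    Function.Injective f.hom.hom ∧ Function.Exact f.hom.hom g.hom.hom := by
  obtain ⟨h⟩ := h
  have congr_hom {A B : FGModuleCat.{u} Λ} {a b : A ⟶ B} (hab : a = b) (x : A) :
      a.hom.hom x = b.hom.hom x := by rw [hab]
  let P : FGModuleCat.{u} Λ := FGModuleCat.of Λ Λ
  refine injective_and_exact_of_lift (congr_hom w) (fun l l' hl => ?_) fun k hk => ?_
  · have : (FGModuleCat.ofHom l : P ⟶ L) = FGModuleCat.ofHom l' :=
      Fork.IsLimit.hom_ext h (FGModuleCat.hom_ext hl)
    exact LinearMap.ext fun x => congr_hom this x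
  · obtain ⟨l, hl⟩ := KernelFork.IsLimit.lift' h (FGModuleCat.ofHom k : P ⟶ M)
      (FGModuleCat.hom_ext hk)
    exact ⟨l.hom.hom, LinearMap.ext fun x => congr_hom hl x⟩

theorem isLimit_of_exact (w : f ≫ g = 0) (hf : Function.Injective (Refl.lin f))
    (hfg : Function.Exact (Refl.lin f) (Refl.lin g)) :
    Nonempty (IsLimit (KernelFork.ofι f w)) := by
  have key : ∀ {W : Refl Λ} (k : W ⟶ M), k ≫ g = 0 → ∃ l : W ⟶ L, l ≫ f = k := fun k hk => by
    obtain ⟨l, hl⟩ := exists_lift hf hfg (Refl.lin k) (Refl.congr_lin hk)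
    exact ⟨Refl.ofLin l, Refl.hom_ext fun x => LinearMap.congr_fun hl x⟩
  choose lift hlift using @key
  exact ⟨KernelFork.IsLimit.ofι f w lift hlift fun k hk m hm => Refl.hom_ext fun x =>
    hf ((Refl.congr_lin hm x).trans (Refl.congr_lin (hlift k hk) x).symm)⟩

theorem isLimit_fgModuleCat_of_exact {L M N : FGModuleCat.{u} Λ} {f : L ⟶ M} {g : M ⟶ N}
    (w : f ≫ g = 0) (hf : Function.Injective f.hom.hom)
    (hfg : Function.Exact f.hom.hom g.hom.hom) : Nonempty (IsLimit (KernelFork.ofι f w)) := by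
  have congr_hom {A B : FGModuleCat.{u} Λ} {a b : A ⟶ B} (hab : a = b) (x : A) :
      a.hom.hom x = b.hom.hom x := by rw [hab]
  have key : ∀ {W : FGModuleCat.{u} Λ} (k : W ⟶ M), k ≫ g = 0 → ∃ l : W ⟶ L, l ≫ f = k :=
    fun k hk => by
      obtain ⟨l, hl⟩ := exists_lift hf hfg k.hom.hom (congr_hom hk)
      exact ⟨FGModuleCat.ofHom l, FGModuleCat.hom_ext hl⟩
  choose lift hlift using @key
  exact ⟨KernelFork.IsLimit.ofι f w lift hlift fun k hk m hm => FGModuleCat.hom_ext <|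
    LinearMap.ext fun x => hf ((congr_hom hm x).trans (congr_hom (hlift k hk) x).symm)⟩

/-- The universal property of the cokernel in `refl Λ` is the extension property of maps into
reflexive modules. -/
theorem isKernelCokernelPair_of_exact (w : f ≫ g = 0) (hf : Function.Injective (Refl.lin f))
    (hfg : Function.Exact (Refl.lin f) (Refl.lin g))
    (hg : ExtendsUniquely Λ Λ (N.obj ⧸ LinearMap.range (Refl.lin g))) :
    IsKernelCokernelPair (ShortComplex.mk f g w) := by
  refine ⟨isLimit_of_exact w hf hfg, ?_⟩
  have key : ∀ {W : Refl Λ} (k : M ⟶ W), f ≫ k = 0 → ∃ l : N ⟶ W, g ≫ l = k := fun {W} k hk => by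
    obtain ⟨l, hl⟩ := hg.exists_extension_reflexive W.property (Refl.lin k)
      fun x hx => by
        obtain ⟨y, rfl⟩ := (hfg x).1 hx
        exact Refl.congr_lin hk y
    exact ⟨Refl.ofLin l, Refl.hom_ext fun x => LinearMap.congr_fun hl x⟩
  choose desc hdesc using @key
  exact ⟨CokernelCofork.IsColimit.ofπ g w desc hdesc fun {W} k hk m hm => Refl.hom_ext fun x =>
    LinearMap.congr_fun (hg.hom_ext_torsionFree (u := Refl.lin m) W.property.1
      fun x => (Refl.congr_lin hm x).trans (Refl.congr_lin (hdesc k hk) x).symm) x⟩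

end Pairs

/-! ### The exact structure of all kernel-cokernel pairs -/

section Preadditive

variable {C : Type*} [Category C] [Preadditive C]

theorem IsKernelCokernelPair.of_iso {S T : ShortComplex C} (e : S ≅ T)
    (h : IsKernelCokernelPair S) : IsKernelCokernelPair T := by
  obtain ⟨⟨hk⟩, ⟨hc⟩⟩ := h
  have e₁₂ : (ShortComplex.π₁.mapIso e).hom ≫ T.f = S.f ≫ (ShortComplex.π₂.mapIso e).hom :=
    e.hom.comm₁₂
  have e₂₃ : (ShortComplex.π₂.mapIso e).hom ≫ T.g = S.g ≫ (ShortComplex.π₃.mapIso e).hom :=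
    e.hom.comm₂₃
  refine ⟨⟨Fork.isLimitOfIsos _ hk (KernelFork.ofι T.f T.zero) (ShortComplex.π₂.mapIso e)
    (ShortComplex.π₃.mapIso e) (ShortComplex.π₁.mapIso e) e₂₃ (by simp) e₁₂⟩,
    ⟨Cofork.isColimitOfIsos _ hc (CokernelCofork.ofπ T.g T.zero) (ShortComplex.π₁.mapIso e)
    (ShortComplex.π₂.mapIso e) (ShortComplex.π₃.mapIso e) e₁₂ (by simp)
    ((Iso.inv_comp_eq (ShortComplex.π₂.mapIso e)).2 e₂₃.symm)⟩⟩

theorem isKernelCokernelPair_id_zero (L Z : C) (hZ : IsZero Z) :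
    IsKernelCokernelPair (ShortComplex.mk (𝟙 L) (0 : L ⟶ Z) comp_zero) :=
  ⟨⟨KernelFork.IsLimit.ofId _ rfl⟩,
    ⟨CokernelCofork.IsColimit.ofEpiOfIsZero _ (inferInstanceAs (Epi (𝟙 L))) hZ⟩⟩

theorem isKernelCokernelPair_zero_id (L Z : C) (hZ : IsZero Z) :
    IsKernelCokernelPair (ShortComplex.mk (0 : Z ⟶ L) (𝟙 L) zero_comp) :=
  ⟨⟨KernelFork.IsLimit.ofMonoOfIsZero _ (inferInstanceAs (Mono (𝟙 L))) hZ⟩,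
    ⟨CokernelCofork.IsColimit.ofId _ rfl⟩⟩

end Preadditive

section ExactStructure

variable {Λ : Type u} [Ring Λ]

theorem isNoetherian_refl [IsNoetherianRing Λ] (M : Refl Λ) : IsNoetherian Λ M.obj :=
  isNoetherian_of_isNoetherianRing_of_finite Λ M.obj

theorem isReflexive_ker [IsNoetherianRing Λᵐᵒᵖ] (hΛ : SGradeExtCondition Λ Λᵐᵒᵖ Λ 2 2)
    {X T : Type u} [AddCommGroup X] [Module Λ X] [Module.Finite Λ X] [AddCommGroup T]
    [Module Λ T] (p : X →ₗ[Λ] T) (hX : Function.Bijective (evalMap Λ X)) (hT : IsTorsionFree Λ T) :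
    Function.Bijective (evalMap Λ (LinearMap.ker p)) :=
  isReflexive_of_exact (extendsUniquely_coker_dual hΛ hT (LinearMap.ker p).subtype p
    Subtype.val_injective (LinearMap.exact_subtype_ker_map p)) Subtype.val_injective
    (LinearMap.exact_subtype_ker_map p) hX hT

variable [IsNoetherianRing Λ] [IsNoetherianRing Λᵐᵒᵖ]

/-- The double dual of a finitely generated module, as an object of `refl Λ`. -/
abbrev Refl.doubleDual (hΛ : SGradeExtCondition Λᵐᵒᵖ Λ Λ 2 2) (X : Type u) [AddCommGroup X]
    [Module Λ X] [Module.Finite Λ X] : Refl Λ :=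
  have := finite_doubleDual Λ X
  Refl.of (DoubleDual Λ X) (extendsUniquely_coker_evalMap hΛ X).isReflexive_doubleDual

variable {L M N : Refl Λ} {f : L ⟶ M} {g : M ⟶ N}

/-- In a kernel-cokernel pair, the third term is the reflexive hull of the cokernel of the first
map, since both have the universal property of the cokernel in `refl Λ`. -/
theorem exists_equiv_of_isKernelCokernelPair (hΛ : SGradeExtCondition Λᵐᵒᵖ Λ Λ 2 2)
    (w : f ≫ g = 0) (h : IsKernelCokernelPair (ShortComplex.mk f g w)) :
    ∃ e : DoubleDual Λ (M.obj ⧸ LinearMap.range (Refl.lin f)) ≃ₗ[Λ] N.obj,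
      Refl.lin g = e.toLinearMap ∘ₗ evalMap Λ (M.obj ⧸ LinearMap.range (Refl.lin f)) ∘ₗ
        (LinearMap.range (Refl.lin f)).mkQ := by
  obtain ⟨hf, hfg⟩ := injective_and_exact_of_isLimit w h.1
  obtain ⟨-, ⟨hc⟩⟩ := h
  have hD := extendsUniquely_coker_evalMap hΛ (M.obj ⧸ LinearMap.range (Refl.lin f))
  let D : Refl Λ := Refl.doubleDual hΛ (M.obj ⧸ LinearMap.range (Refl.lin f))
  let π : M ⟶ D := Refl.ofLin (evalMap Λ _ ∘ₗ (LinearMap.range (Refl.lin f)).mkQ)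
  obtain ⟨t, ht⟩ := CokernelCofork.IsColimit.desc' hc π (Refl.hom_ext fun x =>
    (congrArg (evalMap Λ _) ((Submodule.Quotient.mk_eq_zero (LinearMap.range (Refl.lin f))).2
      (LinearMap.mem_range_self (Refl.lin f) x))).trans (map_zero _))
  have ht' : ∀ x, Refl.lin t (Refl.lin g x) = evalMap Λ _ (Submodule.Quotient.mk x) :=
    fun x => Refl.congr_lin ht x
  obtain ⟨ν, hν⟩ := hD.exists_extension_reflexive N.property (cokerDesc hfg) fun c hc => by
    have hC : IsTorsionFree Λ (M.obj ⧸ LinearMap.range (Refl.lin f)) :=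
      IsTorsionFree.of_injective N.property.1 _ (cokerDesc_injective hfg)
    rw [(map_eq_zero_iff _ hC).1 hc, map_zero]
  have hν' : ∀ x, ν (evalMap Λ _ (Submodule.Quotient.mk x)) = Refl.lin g x :=
    fun x => LinearMap.congr_fun hν (Submodule.Quotient.mk x)
  have h₁ : ν ∘ₗ Refl.lin t = LinearMap.id := by
    have : t ≫ (Refl.ofLin ν : D ⟶ N) = 𝟙 N := Cofork.IsColimit.hom_ext hc <|
      Refl.hom_ext fun x => (congrArg ν (ht' x)).trans (hν' x)
    exact LinearMap.ext fun x => Refl.congr_lin this x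
  have h₂ : Refl.lin t ∘ₗ ν = LinearMap.id := by
    refine hD.hom_ext_torsionFree (isTorsionFree_doubleDual Λ _) fun c => ?_
    obtain ⟨x, rfl⟩ := Submodule.Quotient.mk_surjective _ c
    exact (congrArg (Refl.lin t) (hν' x)).trans (ht' x)
  exact ⟨LinearEquiv.ofLinearMap ν (Refl.lin t) h₁ h₂, LinearMap.ext fun x => (hν' x).symm⟩

theorem isKernelCokernelPair_iff (hΛ : SGradeExtCondition Λᵐᵒᵖ Λ Λ 2 2) (w : f ≫ g = 0) :
    IsKernelCokernelPair (ShortComplex.mk f g w) ↔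
      (Function.Injective (Refl.lin f) ∧ Function.Exact (Refl.lin f) (Refl.lin g)) ∧
        ExtendsUniquely Λ Λ (N.obj ⧸ LinearMap.range (Refl.lin g)) := by
  refine ⟨fun h => ⟨injective_and_exact_of_isLimit w h.1, ?_⟩,
    fun h => isKernelCokernelPair_of_exact w h.1.1 h.1.2 h.2⟩
  obtain ⟨e, he⟩ := exists_equiv_of_isKernelCokernelPair hΛ w h
  exact extendsUniquely_coker_of_equiv (extendsUniquely_coker_evalMap hΛ _)
    (Submodule.mkQ_surjective _) e he

theorem isInflation_iff (hΛ : SGradeExtCondition Λᵐᵒᵖ Λ Λ 2 2) :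
    IsInflation IsKernelCokernelPair f ↔
      Function.Injective (Refl.lin f) ∧
        IsTorsionFree Λ (M.obj ⧸ LinearMap.range (Refl.lin f)) := by
  constructor
  · rintro ⟨N, g, w, h⟩
    obtain ⟨⟨hf, hfg⟩, -⟩ := (isKernelCokernelPair_iff hΛ w).1 h
    exact ⟨hf, IsTorsionFree.of_injective N.property.1 _ (cokerDesc_injective hfg)⟩
  · rintro ⟨hf, hC⟩
    let D : Refl Λ := Refl.doubleDual hΛ (M.obj ⧸ LinearMap.range (Refl.lin f))
    let π : M ⟶ D := Refl.ofLin (evalMap Λ _ ∘ₗ (LinearMap.range (Refl.lin f)).mkQ)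
    have hπ : Function.Exact (Refl.lin f) (Refl.lin π) := fun x =>
      (map_eq_zero_iff _ hC).trans (Submodule.Quotient.mk_eq_zero _)
    have w : f ≫ π = 0 := Refl.hom_ext hπ.apply_apply_eq_zero
    refine ⟨D, π, w, (isKernelCokernelPair_iff hΛ w).2 ⟨⟨hf, hπ⟩, ?_⟩⟩
    exact extendsUniquely_coker_of_equiv (extendsUniquely_coker_evalMap hΛ _)
      (Submodule.mkQ_surjective _) (LinearEquiv.refl Λ _) rfl

theorem isDeflation_iff (hΛ : TwoSidedCondition Λ 2 2) :
    IsDeflation IsKernelCokernelPair g ↔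
      ExtendsUniquely Λ Λ (N.obj ⧸ LinearMap.range (Refl.lin g)) := by
  constructor
  · rintro ⟨L, f, w, h⟩
    exact ((isKernelCokernelPair_iff hΛ.1 w).1 h).2
  · intro hg
    have := isNoetherian_refl M
    let K : Refl Λ := Refl.of (LinearMap.ker (Refl.lin g))
      (isReflexive_ker hΛ.2 (Refl.lin g) M.property N.property.1)
    let i : K ⟶ M := Refl.ofLin (LinearMap.ker (Refl.lin g)).subtype
    have hi : Function.Exact (Refl.lin i) (Refl.lin g) := LinearMap.exact_subtype_ker_map _
    have w : i ≫ g = 0 := Refl.hom_ext hi.apply_apply_eq_zero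
    exact ⟨K, i, w, (isKernelCokernelPair_iff hΛ.1 w).2 ⟨⟨Subtype.val_injective, hi⟩, hg⟩⟩

theorem isInflation_comp (hΛ : TwoSidedCondition Λ 2 2) (hf : IsInflation IsKernelCokernelPair f)
    (hg : IsInflation IsKernelCokernelPair g) : IsInflation IsKernelCokernelPair (f ≫ g) := by
  rw [isInflation_iff hΛ.1] at hf hg ⊢
  refine ⟨hg.1.comp hf.1, ?_⟩
  have hex := exact_cokerMap (Refl.lin f) (Refl.lin g)
  exact isTorsionFree_of_exact (extendsUniquely_coker_dual hΛ.2 hg.2 _ _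
    (cokerMap_injective hg.1) hex) hex hf.2 hg.2

theorem isDeflation_comp (hΛ : TwoSidedCondition Λ 2 2) (hf : IsDeflation IsKernelCokernelPair f)
    (hg : IsDeflation IsKernelCokernelPair g) : IsDeflation IsKernelCokernelPair (f ≫ g) := by
  rw [isDeflation_iff hΛ] at hf hg ⊢
  exact hf.of_exact hg _ _ (exact_cokerMap (Refl.lin f) (Refl.lin g))

theorem exists_pullback (hΛ : TwoSidedCondition Λ 2 2) (w : f ≫ g = 0)
    (h : IsKernelCokernelPair (ShortComplex.mk f g w)) {M' : Refl Λ} (c : M' ⟶ N) :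
    ∃ (P : Refl Λ) (b : P ⟶ M) (f' : L ⟶ P) (g' : P ⟶ M') (w' : f' ≫ g' = 0),
      IsPullback b g' g c ∧ f' ≫ b = f ∧ IsKernelCokernelPair (ShortComplex.mk f' g' w') := by
  obtain ⟨⟨hf, hfg⟩, hg⟩ := (isKernelCokernelPair_iff hΛ.1 w).1 h
  have := isNoetherian_refl M
  have := isNoetherian_refl M'
  let d : M.obj × M'.obj →ₗ[Λ] N.obj := (Refl.lin g).coprod (-Refl.lin c)
  have hd : ∀ m m', d (m, m') = 0 ↔ Refl.lin g m = Refl.lin c m' := fun m m' => by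
    rw [LinearMap.coprod_apply, LinearMap.neg_apply, ← sub_eq_add_neg, sub_eq_zero]
  let P : Refl Λ := Refl.of (LinearMap.ker d)
    (isReflexive_ker hΛ.2 d (isReflexive_prod M M') N.property.1)
  let b : P ⟶ M := Refl.ofLin (LinearMap.fst Λ _ _ ∘ₗ (LinearMap.ker d).subtype)
  let g' : P ⟶ M' := Refl.ofLin (LinearMap.snd Λ _ _ ∘ₗ (LinearMap.ker d).subtype)
  let f' : L ⟶ P := Refl.ofLin (LinearMap.codRestrict (LinearMap.ker d)
    (LinearMap.inl Λ _ _ ∘ₗ Refl.lin f) fun x =>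
      (hd _ _).2 ((hfg.apply_apply_eq_zero x).trans (map_zero _).symm))
  have w' : f' ≫ g' = 0 := Refl.hom_ext fun x => rfl
  have hf' : Function.Injective (Refl.lin f') := fun x y hxy =>
    hf (congrArg (Refl.lin b) hxy)
  have hfg' : Function.Exact (Refl.lin f') (Refl.lin g') := by
    rintro ⟨⟨m, m'⟩, hm⟩
    constructor
    · intro (h0 : m' = 0)
      subst h0
      obtain ⟨x, rfl⟩ := (hfg m).1 (((hd _ _).1 hm).trans (map_zero _))
      exact ⟨x, rfl⟩
    · rintro ⟨x, hx⟩
      exact (congrArg (Refl.lin g') hx).symm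
  have hcomm : ∀ x, Refl.lin g (Refl.lin b x) = Refl.lin c (Refl.lin g' x) :=
    fun x => (hd _ _).1 x.2
  have hle : LinearMap.range (Refl.lin g') ≤ (LinearMap.range (Refl.lin g)).comap (Refl.lin c) := by
    rintro _ ⟨x, rfl⟩
    exact ⟨Refl.lin b x, hcomm x⟩
  refine ⟨P, b, f', g', w', ?_, Refl.hom_ext fun x => rfl,
    (isKernelCokernelPair_iff hΛ.1 w').2 ⟨⟨hf', hfg'⟩, ?_⟩⟩
  · have key : ∀ s : PullbackCone g c, ∃ l : s.pt ⟶ P, l ≫ b = s.fst ∧ l ≫ g' = s.snd := fun s =>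
      ⟨Refl.ofLin (LinearMap.codRestrict (LinearMap.ker d)
        ((Refl.lin s.fst).prod (Refl.lin s.snd)) fun x => (hd _ _).2
          (Refl.congr_lin s.condition x)), rfl, rfl⟩
    choose lift hl₁ hl₂ using key
    refine ⟨⟨Refl.hom_ext hcomm⟩, ⟨PullbackCone.IsLimit.mk _ lift hl₁ hl₂ fun s m h₁ h₂ =>
      Refl.hom_ext fun x => Subtype.ext (Prod.ext ?_ ?_)⟩⟩
    · exact Refl.congr_lin (h₁.trans (hl₁ s).symm) x
    · exact Refl.congr_lin (h₂.trans (hl₂ s).symm) x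
  · -- the cokernel of the base change embeds into the cokernel of `g`
    refine hg.of_injective (Submodule.mapQ _ _ (Refl.lin c) hle)
      ((injective_iff_map_eq_zero _).2 fun y hy => ?_)
    obtain ⟨m', rfl⟩ := Submodule.Quotient.mk_surjective _ y
    obtain ⟨m, hm⟩ := (Submodule.Quotient.mk_eq_zero _).1 hy
    exact (Submodule.Quotient.mk_eq_zero _).2 ⟨⟨(m, m'), (hd _ _).2 hm⟩, rfl⟩

/-- The pushout in `refl Λ` is the double dual of the pushout `E` of modules. It fits into a
conflation because `0 → P → E → Coker f → 0` has torsion-free cokernel, so that taking double duals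
keeps it left exact. -/
theorem exists_pushout (hΛ : TwoSidedCondition Λ 2 2) (w : f ≫ g = 0)
    (h : IsKernelCokernelPair (ShortComplex.mk f g w)) {P : Refl Λ} (a : L ⟶ P) :
    ∃ (Q : Refl Λ) (b : M ⟶ Q) (f' : P ⟶ Q) (g' : Q ⟶ N) (w' : f' ≫ g' = 0),
      IsPushout f a b f' ∧ b ≫ g' = g ∧ IsKernelCokernelPair (ShortComplex.mk f' g' w') := by
  obtain ⟨⟨hf, hfg⟩, hg⟩ := (isKernelCokernelPair_iff hΛ.1 w).1 h
  let r : L.obj →ₗ[Λ] M.obj × P.obj := (Refl.lin f).prod (-Refl.lin a)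
  let j : M.obj →ₗ[Λ] (M.obj × P.obj) ⧸ LinearMap.range r :=
    (LinearMap.range r).mkQ ∘ₗ LinearMap.inl Λ _ _
  let i : P.obj →ₗ[Λ] (M.obj × P.obj) ⧸ LinearMap.range r :=
    (LinearMap.range r).mkQ ∘ₗ LinearMap.inr Λ _ _
  have hji : ∀ m y, Submodule.Quotient.mk (p := LinearMap.range r) (m, y) = j m + i y :=
    fun m y => by
      change _ = Submodule.Quotient.mk (p := LinearMap.range r) ((m, 0) + (0, y))
      simp
  have hcomm : ∀ x, j (Refl.lin f x) = i (Refl.lin a x) := fun x => by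
    refine (Submodule.Quotient.eq _).2 ⟨x, Prod.ext ?_ ?_⟩
    · exact (sub_zero _).symm
    · exact (zero_sub _).symm
  -- the universal property of the pushout of modules
  have hdesc : ∀ {T : Type u} [AddCommGroup T] [Module Λ T] (u : M.obj →ₗ[Λ] T)
      (v : P.obj →ₗ[Λ] T), (∀ x, u (Refl.lin f x) = v (Refl.lin a x)) →
      ∃ t : ((M.obj × P.obj) ⧸ LinearMap.range r) →ₗ[Λ] T,
        (∀ m, t (j m) = u m) ∧ ∀ y, t (i y) = v y := by
    intro T _ _ u v huv
    refine ⟨(LinearMap.range r).liftQ (u.coprod v) ?_, ?_, ?_⟩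
    · rintro _ ⟨x, rfl⟩
      change u (Refl.lin f x) + v (-Refl.lin a x) = 0
      rw [huv, map_neg, add_neg_cancel]
    · intro m
      change u m + v 0 = u m
      rw [map_zero, add_zero]
    · intro y
      change u 0 + v y = v y
      rw [map_zero, zero_add]
  have hfQ : ∀ x, (LinearMap.range (Refl.lin f)).mkQ (Refl.lin f x) = 0 :=
    fun x => (Submodule.Quotient.mk_eq_zero _).2 ⟨x, rfl⟩
  obtain ⟨p, hpj, hpi⟩ := hdesc (LinearMap.range (Refl.lin f)).mkQ 0 hfQ
  obtain ⟨γ, hγj, hγi⟩ := hdesc (Refl.lin g) 0 hfg.apply_apply_eq_zero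
  have hi : Function.Injective i := by
    refine (injective_iff_map_eq_zero _).2 fun y hy => ?_
    obtain ⟨x, hx⟩ := (Submodule.Quotient.mk_eq_zero _).1 hy
    have hx0 : x = 0 := (map_eq_zero_iff _ hf).1 (congrArg Prod.fst hx)
    have := congrArg Prod.snd hx
    change -Refl.lin a x = y at this
    rw [← this, hx0, map_zero, neg_zero]
  have hip : Function.Exact i p := by
    intro e
    constructor
    · intro he
      obtain ⟨⟨m, y⟩, rfl⟩ := Submodule.Quotient.mk_surjective _ e
      rw [hji, map_add, hpj, hpi, LinearMap.zero_apply, add_zero] at he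
      obtain ⟨x, rfl⟩ := (Submodule.Quotient.mk_eq_zero _).1 he
      exact ⟨Refl.lin a x + y, by rw [hji, hcomm, map_add]⟩
    · rintro ⟨y, rfl⟩
      exact hpi y
  have hp : Function.Surjective p := fun c => by
    obtain ⟨m, rfl⟩ := Submodule.mkQ_surjective _ c
    exact ⟨j m, hpj m⟩
  have hC : IsTorsionFree Λ (M.obj ⧸ LinearMap.range (Refl.lin f)) :=
    IsTorsionFree.of_injective N.property.1 _ (cokerDesc_injective hfg)
  have hdual := extendsUniquely_coker_dual hΛ.2 hC i p hi hip
  have hE : IsTorsionFree Λ ((M.obj × P.obj) ⧸ LinearMap.range r) :=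
    isTorsionFree_of_exact hdual hip P.property.1 hC
  have hD := extendsUniquely_coker_evalMap hΛ.1 ((M.obj × P.obj) ⧸ LinearMap.range r)
  let Q : Refl Λ := Refl.doubleDual hΛ.1 ((M.obj × P.obj) ⧸ LinearMap.range r)
  have hext : ∀ {T : Refl Λ} (t : ((M.obj × P.obj) ⧸ LinearMap.range r) →ₗ[Λ] T.obj),
      ∃ t' : Q ⟶ T, ∀ e, Refl.lin t' (evalMap Λ _ e) = t e := by
    intro T t
    obtain ⟨t', ht'⟩ := hD.exists_extension_reflexive T.property t fun e he => by
      rw [(map_eq_zero_iff _ hE).1 he, map_zero]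
    exact ⟨Refl.ofLin t', LinearMap.congr_fun ht'⟩
  let b : M ⟶ Q := Refl.ofLin (evalMap Λ _ ∘ₗ j)
  let f' : P ⟶ Q := Refl.ofLin (evalMap Λ _ ∘ₗ i)
  obtain ⟨g', hg'⟩ := hext γ
  have hbg : b ≫ g' = g := Refl.hom_ext fun m => (hg' (j m)).trans (hγj m)
  have w' : f' ≫ g' = 0 := Refl.hom_ext fun y => (hg' (i y)).trans (hγi y)
  refine ⟨Q, b, f', g', w', ?_, hbg, (isKernelCokernelPair_iff hΛ.1 w').2
    ⟨⟨hE.comp hi, fun Ψ => ⟨fun hΨ => ?_, ?_⟩⟩, ?_⟩⟩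
  · have key : ∀ s : PushoutCocone f a, ∃ l : Q ⟶ s.pt, b ≫ l = s.inl ∧ f' ≫ l = s.inr := by
      intro s
      obtain ⟨t, htj, hti⟩ := hdesc (Refl.lin s.inl) (Refl.lin s.inr)
        (Refl.congr_lin s.condition)
      obtain ⟨t', ht'⟩ := hext t
      exact ⟨t', Refl.hom_ext fun m => (ht' (j m)).trans (htj m),
        Refl.hom_ext fun y => (ht' (i y)).trans (hti y)⟩
    choose desc hd₁ hd₂ using key
    refine ⟨⟨Refl.hom_ext fun x => congrArg (evalMap Λ _) (hcomm x)⟩,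
      ⟨PushoutCocone.IsColimit.mk _ desc hd₁ hd₂ fun s m h₁ h₂ => Refl.hom_ext fun z =>
        LinearMap.congr_fun (hD.hom_ext_torsionFree (u := Refl.lin m) (v := Refl.lin (desc s))
          s.pt.property.1 fun e => ?_) z⟩⟩
    obtain ⟨⟨x, y⟩, rfl⟩ := Submodule.Quotient.mk_surjective _ e
    rw [hji, map_add, map_add, map_add]
    exact congrArg₂ (· + ·) (Refl.congr_lin (h₁.trans (hd₁ s).symm) x)
      (Refl.congr_lin (h₂.trans (hd₂ s).symm) y)
  · refine exists_evalMap_eq hdual hip hp P.property Ψ fun δ => ?_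
    -- a functional on `Coker f` extends to `N`, and its pullbacks to `E^**` are determined on `E`
    obtain ⟨ν, hν⟩ := hg.exists_extension (δ ∘ₗ (LinearMap.range (Refl.lin f)).mkQ) fun m hm => by
      obtain ⟨x, rfl⟩ := (hfg m).1 hm
      exact (congrArg δ (hfQ x)).trans (map_zero δ)
    let evδ : DoubleDual Λ ((M.obj × P.obj) ⧸ LinearMap.range r) →ₗ[Λ] Λ :=
      { toFun := fun Φ => Φ (δ ∘ₗ p), map_add' := fun _ _ => rfl, map_smul' := fun _ _ => rfl }
    have heq : ν ∘ₗ Refl.lin g' = evδ := hD.hom_ext fun e => by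
      obtain ⟨⟨m, y⟩, rfl⟩ := Submodule.Quotient.mk_surjective _ e
      change ν (Refl.lin g' (evalMap Λ _ _)) = δ (p _)
      rw [hg', hji, map_add γ, map_add p, hγj, hγi, hpj, hpi, LinearMap.zero_apply,
        LinearMap.zero_apply, add_zero, add_zero]
      exact LinearMap.congr_fun hν m
    have := LinearMap.congr_fun heq Ψ
    change ν (Refl.lin g' Ψ) = Ψ (δ ∘ₗ p) at this
    rw [← this, hΨ, map_zero]
  · rintro ⟨y, rfl⟩
    exact Refl.congr_lin w' y
  · have hle : LinearMap.range (Refl.lin g) ≤ LinearMap.range (Refl.lin g') := by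
      rintro _ ⟨m, rfl⟩
      exact ⟨Refl.lin b m, Refl.congr_lin hbg m⟩
    exact hg.of_surjective (Submodule.factor hle) (Submodule.factor_surjective hle)

/-- The exact structure on `refl Λ` formed by all kernel-cokernel pairs. -/
def kernelCokernelExactStructure (hΛ : TwoSidedCondition Λ 2 2) : ExactStructure (Refl Λ) where
  conflation := IsKernelCokernelPair
  isKernelCokernelPair _ h := h
  of_iso _ _ e h := h.of_iso e.some
  id_zero := isKernelCokernelPair_id_zero
  zero_id := isKernelCokernelPair_zero_id
  inflation_comp _ _ := isInflation_comp hΛ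
  deflation_comp _ _ := isDeflation_comp hΛ
  pushout S h _ a := exists_pushout hΛ S.zero h a
  pullback S h _ c := exists_pullback hΛ S.zero h c

end ExactStructure

end ReflConflation

open ReflConflation
theorem mainTheorem6 (Λ : Type u) [Ring Λ] [IsNoetherianRing Λ] [IsNoetherianRing Λᵐᵒᵖ]
    (hΛ : TwoSidedCondition Λ 2 2) :
    ∃ E : ExactStructure (Refl Λ), E.IsMaximum ∧
      (∀ S : ShortComplex (Refl Λ), E.conflation S ↔ IsKernelCokernelPair S) ∧
      ∀ (L M N : Refl Λ) (f : L ⟶ M) (g : M ⟶ N) (w : f ≫ g = 0),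
        List.TFAE [
          E.conflation (ShortComplex.mk f g w),
          Nonempty (IsLimit (KernelFork.ofι f.hom
            (show f.hom ≫ g.hom = 0 from congrArg InducedCategory.Hom.hom w))) ∧
            IsTorsionFree Λ (M.obj ⧸ LinearMap.range (Refl.lin f)) ∧
            ∃ e : DoubleDual Λ (M.obj ⧸ LinearMap.range (Refl.lin f)) ≃ₗ[Λ] N.obj,
              Refl.lin g = e.toLinearMap ∘ₗ
                evalMap Λ (M.obj ⧸ LinearMap.range (Refl.lin f)) ∘ₗ
                  (LinearMap.range (Refl.lin f)).mkQ,
          (Function.Injective (Refl.lin f) ∧ Function.Exact (Refl.lin f) (Refl.lin g)) ∧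
            2 ≤ strongGrade Λ Λ (N.obj ⧸ LinearMap.range (Refl.lin g))] := by
  refine ⟨kernelCokernelExactStructure hΛ, fun E' => E'.isKernelCokernelPair, fun S => Iff.rfl,
    fun L M N f g w => ?_⟩
  tfae_have 1 → 2 := fun h => by
    obtain ⟨⟨hf, hfg⟩, -⟩ := (isKernelCokernelPair_iff hΛ.1 w).1 h
    exact ⟨isLimit_fgModuleCat_of_exact _ hf hfg,
      IsTorsionFree.of_injective N.property.1 _ (cokerDesc_injective hfg),
      exists_equiv_of_isKernelCokernelPair hΛ.1 w h⟩
  tfae_have 2 → 3 := fun ⟨hk, _, e, he⟩ =>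
    ⟨injective_and_exact_of_isLimit_fgModuleCat _ hk, (two_le_strongGrade_iff _).2
      (extendsUniquely_coker_of_equiv (extendsUniquely_coker_evalMap hΛ.1 _)
        (Submodule.mkQ_surjective _) e he)⟩
  tfae_have 3 → 1 := fun ⟨h, hs⟩ =>
    (isKernelCokernelPair_iff hΛ.1 w).2 ⟨h, (two_le_strongGrade_iff _).1 hs⟩
  tfae_finish
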